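/- Let $\mathcal H_A,\mathcal H_B$ be complex Hilbert spaces and $\mathcal H_A\otimes\mathcal H_B$ their Hilbert space tensor product. A measuring operation (instrument) is a family $I=\{I_\omega\}$ of completely positive maps on trace class operators whose sum $\sum_\omega I_\omega$ is trace preserving; a quantum operation is a trace preserving completely positive map. An instrument is \emph{with LOCC} if it is implemented by finitely many rounds, in each of which one of the two parties performs an instrument on the local system of that party (which may be replaced by another one, so that ancillas are allowed; at most countably many outcomes), depending on the classical outcomes obtained so far, and communicates the outcome to the other party; at the end both parties apply local quantum operations, and the measured value $\omega$ is a function of the classical record, operations with the same value $\omega$ being added. A quantum operation is with LOCC if it is an LOCC instrument with a single measured value. \textbf{Lemma (generalization of Lo--Popescu).} Let $I=\{I_\omega\}$ be a measuring operation with LOCC on $\mathcal H_A\otimes\mathcal H_B$ and let $\Phi\in\mathcal H_A\otimes\mathcal H_B$ be a unit vector. Then there exist a POVM $\{M_\omega\}$ on $\mathcal H_A$ (every $M_\omega$ is a positive bounded operator and $\sum_\omega M_\omega$ is the identity) and quantum operations $C_\omega$ with LOCC on $\mathcal H_A\otimes\mathcal H_B$ such that $$I_\omega(|\Phi\rangle\langle\Phi|)=C_\omega\Big((\sqrt{M_\omega}\otimes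 \mathrm{id})\,|\Phi\rangle\langle\Phi|\,(\sqrt{M_\omega}\otimes \mathrm{id})\Big)\qquad\text{for all }\omega .$$ -/

import Mathlib

open scoped TensorProduct ComplexOrder

noncomputable section

namespace LOCC

universe u v w

/-! ### Trace class operators, states, operations and instruments -/

section Basic

variable (H : Type u) [NormedAddCommGroup H] [InnerProductSpace ℂ H] [CompleteSpace H]

/-- Index set of a fixed orthonormal (Hilbert) basis of the Hilbert space `H`. -/
def basisIndex : Set H := (exists_hilbertBasis ℂ H).choose

/-- A fixed orthonormal (Hilbert) basis of the Hilbert space `H`. -/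
def basis : HilbertBasis (basisIndex H) ℂ H := (exists_hilbertBasis ℂ H).choose_spec.choose

/-- The space of trace class operators on `H`: the linear span of the positive bounded operators
`T` with `∑ i, ⟪e i, T (e i)⟫ < ∞` for an orthonormal basis `e`. -/
def traceClass : Submodule ℂ (H →L[ℂ] H) :=
  Submodule.span ℂ
    {T | T.IsPositive ∧ Summable fun i => inner ℂ (basis H i) (T (basis H i))}

variable {H}

/-- The trace of a trace class operator. -/
def trace (T : traceClass H) : ℂ := ∑' i, inner ℂ (basis H i) (T.1 (basis H i))

/-- The rank one operator `|x⟩⟨x|` is of trace class. -/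
theorem ketbra_mem_traceClass (x : H) : InnerProductSpace.rankOne ℂ x x ∈ traceClass H := by
  refine Submodule.subset_span ⟨?_, ?_⟩
  · exact InnerProductSpace.isPositive_rankOne_self x
  · have h := (basis H).summable_inner_mul_inner x x
    refine h.congr fun i => ?_
    simp [InnerProductSpace.rankOne_apply]

/-- The operator `|x⟩⟨x|`; for a unit vector `x` this is the pure state with state vector `x`. -/
def ketbra (x : H) : traceClass H := ⟨InnerProductSpace.rankOne ℂ x x, ketbra_mem_traceClass x⟩

end Basic

section Operations

variable {H : Type u} [NormedAddCommGroup H] [InnerProductSpace ℂ H] [CompleteSpace H]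
variable {K : Type v} [NormedAddCommGroup K] [InnerProductSpace ℂ K] [CompleteSpace K]

/-- `S |x⟩⟨x| S* = |S x⟩⟨S x|`. -/
theorem ketbra_map (S : H →L[ℂ] K) (x : H) :
    (ketbra (S x)).1 = S ∘L (ketbra x).1 ∘L ContinuousLinearMap.adjoint S := by
  ext y
  simp [ketbra, InnerProductSpace.rankOne_apply, ContinuousLinearMap.adjoint_inner_right]

/-- An `n × n` matrix of trace class operators on `H` is positive if it is positive as an operator
on the direct sum of `n` copies of `H`, that is, on `ℂⁿ ⊗ H`. -/
def BlockPositive {n : ℕ} (ρ : Matrix (Fin n) (Fin n) (traceClass H)) : Prop :=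
  ∀ ξ : Fin n → H, 0 ≤ ∑ i, ∑ j, inner ℂ (ξ i) ((ρ i j).1 (ξ j))

variable (H K) in
/-- Linear maps from the trace class operators on `H` to those on `K`. -/
abbrev Op := traceClass H →ₗ[ℂ] traceClass K

/-- Complete positivity: `id ⊗ E` maps positive operators on `ℂⁿ ⊗ H` to positive operators on
`ℂⁿ ⊗ K`, for every `n`. -/
def IsCP (E : Op H K) : Prop :=
  ∀ (n : ℕ) (ρ : Matrix (Fin n) (Fin n) (traceClass H)),
    BlockPositive ρ → BlockPositive fun i j => E (ρ i j)

/-- A measuring operation (instrument): a family of completely positive maps whose sum is trace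
preserving. -/
def IsInstrument {Ω : Type w} (I : Ω → Op H K) : Prop :=
  (∀ ω, IsCP (I ω)) ∧ ∀ ρ : traceClass H, HasSum (fun ω => trace (I ω ρ)) (trace ρ)

/-- A quantum operation: a trace preserving completely positive map. -/
def IsTPCP (E : Op H K) : Prop :=
  IsCP E ∧ ∀ ρ : traceClass H, trace (E ρ) = trace ρ

/-- A POVM: a family of positive operators whose sum (in the strong operator topology) is the
identity. -/
def IsPOVM {Ω : Type w} (M : Ω → H →L[ℂ] H) : Prop :=
  (∀ ω, (M ω).IsPositive) ∧ ∀ x : H, HasSum (fun ω => M ω x) x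

end Operations

/-! ### Bipartite systems -/

section Bipartite

/-- The Hilbert space tensor product `A ⊗ B` (the completion of the algebraic one). -/
abbrev HTensor (A : Type u) (B : Type v) [NormedAddCommGroup A] [InnerProductSpace ℂ A]
    [NormedAddCommGroup B] [InnerProductSpace ℂ B] :=
  UniformSpace.Completion (A ⊗[ℂ] B)

variable {A A' : Type u} {B B' : Type v}
variable [NormedAddCommGroup A] [InnerProductSpace ℂ A]
variable [NormedAddCommGroup B] [InnerProductSpace ℂ B]
variable [NormedAddCommGroup A'] [InnerProductSpace ℂ A']
variable [NormedAddCommGroup B'] [InnerProductSpace ℂ B']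

/-- The product vector `a ⊗ b`. -/
def tens (a : A) (b : B) : HTensor A B := ((a ⊗ₜ[ℂ] b : A ⊗[ℂ] B) : HTensor A B)

/-- The tensor product `X ⊗ Y` of two bounded operators, `(X ⊗ Y)(a ⊗ b) = X a ⊗ Y b`. -/
def opTensor (X : A →L[ℂ] A') (Y : B →L[ℂ] B') : HTensor A B →L[ℂ] HTensor A' B' :=
  (TensorProduct.mapL X Y).completion

variable [CompleteSpace A] [CompleteSpace B] [CompleteSpace A'] [CompleteSpace B']

/-- `F` is the tensor product `E ⊗ G` of the maps `E` (on Alice's side) and `G` (on Bob's side):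
the completely positive map with `F (|a⟩⟨a| ⊗ |b⟩⟨b|) = E (|a⟩⟨a|) ⊗ G (|b⟩⟨b|)`.
By linearity and polarization this fixes `F` on all operators `|a⟩⟨a'| ⊗ |b⟩⟨b'|`; as positive
maps are continuous in the trace norm, it fixes `F`. -/
def IsTensorOp (F : Op (HTensor A B) (HTensor A' B')) (E : Op A A') (G : Op B B') : Prop :=
  IsCP F ∧ ∀ (a : A) (b : B),
    (F (ketbra (tens a b))).1 = opTensor (E (ketbra a)).1 (G (ketbra b)).1

/-- The instrument `F = (F k)` on the bipartite system is the instrument `J = (J k)` performed by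
Alice on her system, Bob doing nothing: `F k = J k ⊗ id`. -/
def IsLocalAlice (F : ℕ → Op (HTensor A B) (HTensor A' B)) : Prop :=
  IsInstrument F ∧ ∃ J : ℕ → Op A A', IsInstrument J ∧ ∀ k, IsTensorOp (F k) (J k) LinearMap.id

/-- The instrument `F = (F k)` on the bipartite system is the instrument `J = (J k)` performed by
Bob on his system, Alice doing nothing: `F k = id ⊗ J k`. -/
def IsLocalBob (F : ℕ → Op (HTensor A B) (HTensor A B')) : Prop :=
  IsInstrument F ∧ ∃ J : ℕ → Op B B', IsInstrument J ∧ ∀ k, IsTensorOp (F k) LinearMap.id (J k)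

end Bipartite

/-! ### LOCC -/

section Protocols

variable {Ω : Type w} (A' : Type u) (B' : Type v)
variable [NormedAddCommGroup A'] [InnerProductSpace ℂ A'] [CompleteSpace A']
variable [NormedAddCommGroup B'] [InnerProductSpace ℂ B'] [CompleteSpace B']

/-- `IsLOCCRounds A' B' n A B I` means that the family `I` of operations from `A ⊗ B` to `A' ⊗ B'`
is implemented by local operations and `n` rounds of classical communication.

* With no round left, Alice and Bob apply local quantum operations, and the measured value is
  a fixed `ω₀` (which is determined by the classical record of the preceding rounds).
* Otherwise one of the two parties performs an instrument `F` on the system of that party, which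
  may change this system (so that it may contain ancillas), and sends the outcome `k` to the
  other party; then they follow a protocol `P k` with one round less, which depends on `k`.
  Outcomes are numbered by natural numbers (finitely many outcomes: `F k = 0` for the other `k`).

Different classical records may lead to the same `ω`; the corresponding operations are added up
(the sums are of positive operators for positive `ρ`, and converge). -/
def IsLOCCRounds : (n : ℕ) → (A : Type u) → (B : Type v) →
    [NormedAddCommGroup A] → [InnerProductSpace ℂ A] → [CompleteSpace A] →
    [NormedAddCommGroup B] → [InnerProductSpace ℂ B] → [CompleteSpace B] →
    (Ω → Op (HTensor A B) (HTensor A' B')) → Prop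
  | 0, A, B, _, _, _, _, _, _, I =>
      ∃ (ω₀ : Ω) (E : Op A A') (G : Op B B'), IsTPCP E ∧ IsTPCP G ∧
        IsTPCP (I ω₀) ∧ IsTensorOp (I ω₀) E G ∧ ∀ ω, ω ≠ ω₀ → I ω = 0
  | n + 1, A, B, _, _, _, _, _, _, I =>
      (∃ (A₁ : Type u) (_ : NormedAddCommGroup A₁) (_ : InnerProductSpace ℂ A₁)
        (_ : CompleteSpace A₁)
        (F : ℕ → Op (HTensor A B) (HTensor A₁ B))
        (P : ℕ → Ω → Op (HTensor A₁ B) (HTensor A' B')),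
        IsLocalAlice F ∧ (∀ k, IsLOCCRounds n A₁ B (P k)) ∧
        ∀ ω ρ, HasSum (fun k => (P k ω (F k ρ)).1) (I ω ρ).1) ∨
      (∃ (B₁ : Type v) (_ : NormedAddCommGroup B₁) (_ : InnerProductSpace ℂ B₁)
        (_ : CompleteSpace B₁)
        (F : ℕ → Op (HTensor A B) (HTensor A B₁))
        (P : ℕ → Ω → Op (HTensor A B₁) (HTensor A' B')),
        IsLocalBob F ∧ (∀ k, IsLOCCRounds n A B₁ (P k)) ∧
        ∀ ω ρ, HasSum (fun k => (P k ω (F k ρ)).1) (I ω ρ).1)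

variable {A' B'} {A : Type u} {B : Type v}
variable [NormedAddCommGroup A] [InnerProductSpace ℂ A] [CompleteSpace A]
variable [NormedAddCommGroup B] [InnerProductSpace ℂ B] [CompleteSpace B]

/-- A measuring operation with LOCC: an instrument implemented by local operations and finitely
many rounds of classical communication. -/
def IsLOCCInstrument (I : Ω → Op (HTensor A B) (HTensor A' B')) : Prop :=
  IsInstrument I ∧ ∃ n, IsLOCCRounds A' B' n A B I

/-- A quantum operation with LOCC: an LOCC measuring operation with a single measured value. -/
def IsLOCCOperation (C : Op (HTensor A B) (HTensor A' B')) : Prop :=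
  IsTPCP C ∧ ∃ n, IsLOCCRounds A' B' n A B fun _ : Unit => C

end Protocols

end LOCC

end

open LOCC

/-! The argument is Lo and Popescu's: on a known pure state, a measurement by Bob can be replaced by
a measurement by Alice followed by a correction on Bob's side. Induction on the number of rounds
proves the statement `Simulates`: for each vector `x` there are operators `X ω` of Alice with `∑ X
ω* X ω ≤ 1`, losing no norm on `x`, and LOCC channels `C ω` with `I ω (|x⟩⟨x|) = C ω (|(X ω ⊗ 1)
x⟩⟨(X ω ⊗ 1) x|)`.

No general Kraus representation is needed, since only one vector matters at each step. Decompose the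
output of a round on `|x⟩⟨x|` into rank one pieces `|ψ i⟩⟨ψ i|`. If Alice acted, Bob's reduced state
is unchanged (`IsLocalAlice.tsum_sliceA`), so Douglas' lemma (`exists_family_comp_eq`), applied to
the vectors read as maps `B → A`, gives `ψ i = (K i ⊗ 1) x` with `∑ K i* K i ≤ 1`
(`exists_kraus_left`). If Bob acted, then likewise `ψ i = (1 ⊗ R i) x`; reading `x` as a map `A → B`
and using polar decompositions, `exists_simulation` rewrites this as `ψ i = (N i ⊗ V i) x` with `∑ N
i* N i ≤ 1` and contractions `V i`. Equality of total norms forces each `V i` to preserve the norms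
of the vectors it meets, so completing it to an instrument adds only an outcome of probability zero.

The induction hypothesis at each `ψ i` provides operators `Y i ω`. For fixed `ω` the products `Y i ω
K i` (or `Y i ω N i`) are merged into one `X ω` with `X* X = ∑ᵢ (Y i ω K i)* (Y i ω K i)`. Douglas'
lemma recovers them as `L ω i X ω`, and measuring the `L ω i` becomes the first round of `C ω`
(`exists_simulates_of_kraus`).

Finally the defect `S* S = 1 - ∑ X ω* X ω` satisfies `(S ⊗ 1) x = 0`, so it may be added to one
effect. This gives a POVM, and `X ω = L √(M ω)` with a contraction `L` that is absorbed into the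
channel (`Simulates.exists_povm`). -/

noncomputable section

namespace LOCC

open scoped ENNReal NNReal
open ContinuousLinearMap (adjoint)

/-! ### Traces of positive operators with values in `[0, ∞]` -/

section Trace

variable {H : Type*} [NormedAddCommGroup H] [InnerProductSpace ℂ H]

theorem enorm_sq_eq_ofReal {E : Type*} [SeminormedAddCommGroup E] (x : E) :
    ‖x‖ₑ ^ 2 = ENNReal.ofReal (‖x‖ ^ 2) := by
  rw [← ofReal_norm, ENNReal.ofReal_pow (norm_nonneg x)]

theorem norm_le_of_enorm_sq_le {E F : Type*} [SeminormedAddCommGroup E] [SeminormedAddCommGroup F]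
    {x : E} {y : F} (h : ‖x‖ₑ ^ 2 ≤ ‖y‖ₑ ^ 2) : ‖x‖ ≤ ‖y‖ := by
  rw [enorm_sq_eq_ofReal, enorm_sq_eq_ofReal, ENNReal.ofReal_le_ofReal_iff (by positivity)] at h
  exact (sq_le_sq₀ (norm_nonneg _) (norm_nonneg _)).1 h

theorem enorm_inner_le {E : Type*} [NormedAddCommGroup E] [InnerProductSpace ℂ E] (x y : E) :
    ‖inner ℂ x y‖ₑ ≤ ‖x‖ₑ * ‖y‖ₑ := by
  rw [← ofReal_norm, ← ofReal_norm, ← ofReal_norm, ← ENNReal.ofReal_mul (norm_nonneg _)]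
  exact ENNReal.ofReal_le_ofReal (norm_inner_le_norm x y)

theorem enorm_sq_ne_top {E : Type*} [SeminormedAddCommGroup E] (x : E) : ‖x‖ₑ ^ 2 ≠ ∞ :=
  ENNReal.pow_ne_top enorm_ne_top

/-- Parseval's identity, with values in `[0, ∞]`. -/
theorem tsum_enorm_inner_sq {ι : Type*} (b : HilbertBasis ι ℂ H) (x : H) :
    ∑' i, ‖inner ℂ (b i) x‖ₑ ^ 2 = ‖x‖ₑ ^ 2 := by
  have h := b.hasSum_inner_mul_inner x x
  have h2 : HasSum (fun i => ‖inner ℂ (b i) x‖ ^ 2) (‖x‖ ^ 2) := by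
    have h3 := Complex.hasSum_re h
    rw [inner_self_eq_norm_sq_to_K] at h3
    convert h3 using 1
    · ext i
      rw [← inner_conj_symm x (b i), ← Complex.normSq_eq_conj_mul_self, Complex.ofReal_re,
        Complex.normSq_eq_norm_sq]
    · norm_cast
  simp only [enorm_sq_eq_ofReal]
  rw [← h2.tsum_eq, ENNReal.ofReal_tsum_of_nonneg (fun i => by positivity) h2.summable]

/-- The quadratic form `⟪x, T x⟫` of a positive operator, as an element of `[0, ∞]`. -/
def qf (T : H →L[ℂ] H) (x : H) : ℝ≥0∞ := ENNReal.ofReal (inner ℂ x (T x)).re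

/-- `T = ∑ i, |ψ i⟩⟨ψ i|` in the sense of quadratic forms. -/
def IsDecomp {ι : Type*} (T : H →L[ℂ] H) (ψ : ι → H) : Prop :=
  ∀ x, ∑' i, ‖inner ℂ (ψ i) x‖ₑ ^ 2 = qf T x

variable [CompleteSpace H]

/-- The trace of a positive operator, as an element of `[0, ∞]`. -/
def ptr (T : H →L[ℂ] H) : ℝ≥0∞ := ∑' i, qf T (basis H i)

/-- Tonelli and Parseval in the other index; no summability has to be checked in `[0, ∞]`. -/
theorem IsDecomp.ptr_eq {ι : Type*} {T : H →L[ℂ] H} {ψ : ι → H} (h : IsDecomp T ψ) :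
    ptr T = ∑' i, ‖ψ i‖ₑ ^ 2 := by
  simp only [ptr, ← h _]
  rw [ENNReal.tsum_comm]
  refine tsum_congr fun i => ?_
  rw [← tsum_enorm_inner_sq (basis H) (ψ i)]
  refine tsum_congr fun j => ?_
  rw [← inner_conj_symm, RCLike.enorm_conj]

theorem re_inner_eq_norm_sqrt_sq {T : H →L[ℂ] H} (hT : T.IsPositive) (x : H) :
    inner ℂ x (T x) = ((‖CFC.sqrt T x‖ ^ 2 : ℝ) : ℂ) := by
  have h0 : 0 ≤ T := (ContinuousLinearMap.nonneg_iff_isPositive T).2 hT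
  have h1 : CFC.sqrt T * CFC.sqrt T = T := CFC.sqrt_mul_sqrt_self T h0
  have h2 : (CFC.sqrt T).IsPositive :=
    (ContinuousLinearMap.nonneg_iff_isPositive _).1 (CFC.sqrt_nonneg T)
  conv_lhs => rw [← h1]
  rw [mul_apply_eq_comp, ← h2.inner_left_eq_inner_right, inner_self_eq_norm_sq_to_K]
  norm_cast

theorem qf_eq_sqrt {T : H →L[ℂ] H} (hT : T.IsPositive) (x : H) :
    qf T x = ‖CFC.sqrt T x‖ₑ ^ 2 := by
  rw [qf, re_inner_eq_norm_sqrt_sq hT, enorm_sq_eq_ofReal, Complex.ofReal_re]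

theorem sqrt_inner_comm (T : H →L[ℂ] H) (x y : H) :
    inner ℂ (CFC.sqrt T x) y = inner ℂ x (CFC.sqrt T y) :=
  ((ContinuousLinearMap.nonneg_iff_isPositive _).1 (CFC.sqrt_nonneg T)).inner_left_eq_inner_right
    x y

theorem isDecomp_sqrt {T : H →L[ℂ] H} (hT : T.IsPositive) :
    IsDecomp T fun i => CFC.sqrt T (basis H i) := by
  intro x
  simp only [sqrt_inner_comm, tsum_enorm_inner_sq, qf_eq_sqrt hT]

theorem IsDecomp.conj {ι K : Type*} [NormedAddCommGroup K] [InnerProductSpace ℂ K]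
    [CompleteSpace K] {T : H →L[ℂ] H} {ψ : ι → H} (h : IsDecomp T ψ) (S : H →L[ℂ] K) :
    IsDecomp (S ∘L T ∘L adjoint S) fun i => S (ψ i) := by
  intro x
  simp only [← ContinuousLinearMap.adjoint_inner_right, h (adjoint S x), qf]
  simp

omit [CompleteSpace H] in
theorem isDecomp_rankOne (x : H) :
    IsDecomp (InnerProductSpace.rankOne ℂ x x) fun _ : Unit => x := by
  intro y
  simp only [tsum_fintype, Finset.univ_unique, Finset.sum_const, Finset.card_singleton, one_smul,
    qf, InnerProductSpace.rankOne_apply, inner_smul_right]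
  rw [enorm_sq_eq_ofReal, ← inner_conj_symm y x, Complex.mul_conj, Complex.ofReal_re,
    Complex.normSq_eq_norm_sq]

theorem ptr_ketbra (x : H) : ptr (ketbra x).1 = ‖x‖ₑ ^ 2 := by
  have h : IsDecomp (ketbra x).1 fun _ : Unit => x := isDecomp_rankOne x
  rw [h.ptr_eq]
  simp

theorem ketbra_isPositive (x : H) : (ketbra x).1.IsPositive :=
  InnerProductSpace.isPositive_rankOne_self x

theorem inner_eq_qf {T : H →L[ℂ] H} (hT : T.IsPositive) (x : H) :
    inner ℂ x (T x) = (((qf T x).toReal : ℝ) : ℂ) := by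
  rw [re_inner_eq_norm_sqrt_sq hT, qf, re_inner_eq_norm_sqrt_sq hT, Complex.ofReal_re,
    ENNReal.toReal_ofReal (by positivity)]

omit [CompleteSpace H] in
theorem qf_ne_top (T : H →L[ℂ] H) (x : H) : qf T x ≠ ∞ := ENNReal.ofReal_ne_top

theorem summable_diag {T : H →L[ℂ] H} (hT : T ∈ traceClass H) :
    Summable fun i => inner ℂ (basis H i) (T (basis H i)) := by
  induction hT using Submodule.span_induction with
  | mem x h => exact h.2
  | zero => simp
  | add x y _ _ hx hy => simpa [inner_add_right] using hx.add hy
  | smul a x _ hx => simpa [inner_smul_right] using hx.mul_left a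

theorem mem_traceClass_of_ptr {T : H →L[ℂ] H} (hT : T.IsPositive) (h : ptr T ≠ ∞) :
    T ∈ traceClass H := by
  refine Submodule.subset_span ⟨hT, ?_⟩
  simp only [inner_eq_qf hT]
  exact (Complex.hasSum_ofReal.2 (ENNReal.summable_toReal h).hasSum).summable

theorem ptr_ne_top {T : H →L[ℂ] H} (hT : T.IsPositive) (h : T ∈ traceClass H) : ptr T ≠ ∞ := by
  have h1 := summable_diag h
  simp only [inner_eq_qf hT] at h1
  have h2 := (Complex.hasSum_re h1.hasSum).summable
  simp only [Complex.ofReal_re] at h2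
  have h3 := ENNReal.ofReal_tsum_of_nonneg (fun i => ENNReal.toReal_nonneg) h2
  simp only [ENNReal.ofReal_toReal (qf_ne_top T _)] at h3
  rw [ptr, ← h3]
  exact ENNReal.ofReal_ne_top

theorem trace_eq_ptr (ρ : traceClass H) (hρ : ρ.1.IsPositive) :
    trace ρ = (((ptr ρ.1).toReal : ℝ) : ℂ) := by
  rw [trace, ptr, ENNReal.tsum_toReal_eq (fun i => qf_ne_top _ _), Complex.ofReal_tsum]
  exact tsum_congr fun i => inner_eq_qf hρ _

/-- The trace as a linear functional. -/
def traceL (H : Type*) [NormedAddCommGroup H] [InnerProductSpace ℂ H] [CompleteSpace H] :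
    traceClass H →ₗ[ℂ] ℂ where
  toFun := trace
  map_add' ρ σ := by
    simp only [trace]
    rw [← (summable_diag ρ.2).tsum_add (summable_diag σ.2)]
    simp
  map_smul' c ρ := by
    simp only [trace]
    rw [RingHom.id_apply, smul_eq_mul, ← tsum_mul_left]
    simp

@[simp] theorem traceL_apply (ρ : traceClass H) : traceL H ρ = trace ρ := rfl

/-- Induction principle: every trace class operator is a linear combination of positive ones. -/
theorem traceClass_induction {p : traceClass H → Prop}
    (pos : ∀ ρ : traceClass H, ρ.1.IsPositive → p ρ)
    (add : ∀ ρ σ, p ρ → p σ → p (ρ + σ)) (smul : ∀ (c : ℂ) ρ, p ρ → p (c • ρ))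
    (ρ : traceClass H) : p ρ := by
  obtain ⟨T, hT⟩ := ρ
  induction hT using Submodule.span_induction with
  | mem x h => exact pos ⟨x, Submodule.subset_span h⟩ h.1
  | zero => exact pos 0 ContinuousLinearMap.isPositive_zero
  | add x y hx' hy' hx hy => exact add ⟨x, hx'⟩ ⟨y, hy'⟩ hx hy
  | smul a x hx' hx => exact smul a ⟨x, hx'⟩ hx

/-- Cauchy–Schwarz in the decomposition by `√T` bounds `‖√T‖²` by the trace. This bound converts
finiteness of traces into operator norm convergence. -/
theorem enorm_le_ptr {T : H →L[ℂ] H} (hT : T.IsPositive) : ‖T‖ₑ ≤ ptr T := by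
  by_cases hf : ptr T = ∞
  · simp [hf]
  have hb : ∀ x, ‖CFC.sqrt T x‖ ^ 2 ≤ (ptr T).toReal * ‖x‖ ^ 2 := by
    intro x
    have h1 : ‖CFC.sqrt T x‖ₑ ^ 2 ≤ ptr T * ‖x‖ₑ ^ 2 := by
      rw [← qf_eq_sqrt hT, ← isDecomp_sqrt hT x, (isDecomp_sqrt hT).ptr_eq, ← ENNReal.tsum_mul_right]
      refine ENNReal.tsum_le_tsum fun i => ?_
      rw [← mul_pow]
      gcongr
      exact enorm_inner_le _ _
    rw [enorm_sq_eq_ofReal, enorm_sq_eq_ofReal, ← ENNReal.ofReal_toReal hf,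
      ← ENNReal.ofReal_mul ENNReal.toReal_nonneg,
      ENNReal.ofReal_le_ofReal_iff (by positivity)] at h1
    exact h1
  have h0 : 0 ≤ T := (ContinuousLinearMap.nonneg_iff_isPositive T).2 hT
  have h2 : ‖CFC.sqrt T‖ ≤ √(ptr T).toReal := by
    refine ContinuousLinearMap.opNorm_le_bound _ (Real.sqrt_nonneg _) fun x => ?_
    refine (sq_le_sq₀ (norm_nonneg _) (by positivity)).1 ?_
    rw [mul_pow, Real.sq_sqrt ENNReal.toReal_nonneg]
    exact hb x
  have h3 : ‖T‖ ≤ (ptr T).toReal := by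
    conv_lhs => rw [← CFC.sqrt_mul_sqrt_self T h0]
    refine (norm_mul_le _ _).trans ?_
    rw [← Real.mul_self_sqrt (ENNReal.toReal_nonneg (a := ptr T))]
    gcongr
  rw [← ofReal_norm]
  exact ENNReal.ofReal_le_of_le_toReal h3

omit [CompleteSpace H] in
theorem isPositive_of_hasSum {ι : Type*} {T : ι → H →L[ℂ] H} {S : H →L[ℂ] H} (h : HasSum T S)
    (hT : ∀ i, (T i).IsPositive) : S.IsPositive := by
  rw [ContinuousLinearMap.isPositive_iff_complex]
  intro x
  have h1 : HasSum (fun i => inner ℂ (T i x) x) (inner ℂ (S x) x) := by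
    have h2 := h.mapL (ContinuousLinearMap.apply ℂ H x)
    exact (h2.map ((innerSLFlip ℂ x).toLinearMap.toAddMonoidHom : H →+ ℂ) (innerSLFlip ℂ x).continuous)
  have h3 : 0 ≤ inner ℂ (S x) x := h1.nonneg fun i => (hT i).inner_nonneg_left x
  rw [Complex.nonneg_iff] at h3
  refine ⟨?_, h3.1⟩
  apply Complex.ext <;> simp [← h3.2]

omit [CompleteSpace H] in
theorem qf_hasSum {ι : Type*} {T : ι → H →L[ℂ] H} {S : H →L[ℂ] H} (h : HasSum T S)
    (hT : ∀ i, (T i).IsPositive) (x : H) : qf S x = ∑' i, qf (T i) x := by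
  have h1 : HasSum (fun i => (inner ℂ x (T i x)).re) (inner ℂ x (S x)).re := by
    have h2 := (h.mapL (ContinuousLinearMap.apply ℂ H x)).mapL (innerSL ℂ x)
    exact Complex.hasSum_re h2
  rw [qf, ← h1.tsum_eq]
  exact ENNReal.ofReal_tsum_of_nonneg (fun i => (hT i).re_inner_nonneg_right x) h1.summable

theorem ptr_hasSum {ι : Type*} {T : ι → H →L[ℂ] H} {S : H →L[ℂ] H} (h : HasSum T S)
    (hT : ∀ i, (T i).IsPositive) : ptr S = ∑' i, ptr (T i) := by
  simp only [ptr, qf_hasSum h hT]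
  exact ENNReal.tsum_comm

theorem summable_of_tsum_ptr {ι : Type*} {T : ι → H →L[ℂ] H} (hT : ∀ i, (T i).IsPositive)
    (h : ∑' i, ptr (T i) ≠ ∞) : Summable T := by
  refine Summable.of_norm_bounded (ENNReal.summable_toReal h) fun i => ?_
  rw [← toReal_enorm]
  exact ENNReal.toReal_mono (ENNReal.ne_top_of_tsum_ne_top h i) (enorm_le_ptr (hT i))

end Trace

/-! ### Positive maps, conjugations and sums of operations -/

section Ops

variable {H K L : Type*} [NormedAddCommGroup H] [InnerProductSpace ℂ H] [CompleteSpace H]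
  [NormedAddCommGroup K] [InnerProductSpace ℂ K] [CompleteSpace K]
  [NormedAddCommGroup L] [InnerProductSpace ℂ L] [CompleteSpace L]

/-- `E` maps positive operators to positive ones and increases their trace at most by the
factor `c`. -/
def IsBoundedPos (E : Op H K) (c : ℝ≥0) : Prop :=
  ∀ ρ : traceClass H, ρ.1.IsPositive → (E ρ).1.IsPositive ∧ ptr (E ρ).1 ≤ c * ptr ρ.1

theorem IsCP.isPositive {E : Op H K} (h : IsCP E) (ρ : traceClass H) (hρ : ρ.1.IsPositive) :
    (E ρ).1.IsPositive := by
  have h1 := h 1 (fun _ _ => ρ) fun ξ => by simpa using hρ.inner_nonneg_right (ξ 0)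
  rw [ContinuousLinearMap.isPositive_iff_complex]
  intro x
  have h2 := h1 fun _ => x
  simp only [Finset.univ_unique, Finset.sum_const, Finset.card_singleton, one_smul] at h2
  rw [← inner_conj_symm, Complex.nonneg_iff] at h2
  simp only [Complex.conj_re, Complex.conj_im] at h2
  refine ⟨?_, h2.1⟩
  apply Complex.ext
  · simp
  · simp
    linarith [h2.2]

theorem IsTPCP.ptr_eq {E : Op H K} (h : IsTPCP E) (ρ : traceClass H) (hρ : ρ.1.IsPositive) :
    ptr (E ρ).1 = ptr ρ.1 := by
  have h1 := h.2 ρ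
  have h2 := h.1.isPositive ρ hρ
  rw [trace_eq_ptr _ hρ, trace_eq_ptr _ h2] at h1
  exact (ENNReal.toReal_eq_toReal_iff' (ptr_ne_top h2 (E ρ).2) (ptr_ne_top hρ ρ.2)).1
    (by exact_mod_cast h1)

theorem IsTPCP.isBoundedPos {E : Op H K} (h : IsTPCP E) : IsBoundedPos E 1 := fun ρ hρ =>
  ⟨h.1.isPositive ρ hρ, by simp [h.ptr_eq ρ hρ]⟩

/-- Both traces are linear and positive operators span the trace class, so positive `ρ` suffice. -/
theorem isTPCP_of_ptr {E : Op H K} (h : IsCP E)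
    (h2 : ∀ ρ : traceClass H, ρ.1.IsPositive → ptr (E ρ).1 = ptr ρ.1) : IsTPCP E := by
  refine ⟨h, fun ρ => ?_⟩
  suffices traceL K ∘ₗ E = traceL H from LinearMap.congr_fun this ρ
  ext ρ
  simp only [LinearMap.comp_apply]
  induction ρ using traceClass_induction with
  | pos ρ hρ => simp [trace_eq_ptr _ hρ, trace_eq_ptr _ (h.isPositive ρ hρ), h2 ρ hρ]
  | add ρ σ h3 h4 => simp only [map_add, h3, h4]
  | smul c ρ h3 => simp only [map_smul, h3]

theorem IsInstrument.tsum_ptr {Ω : Type*} {I : Ω → Op H K} (h : IsInstrument I)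
    (ρ : traceClass H) (hρ : ρ.1.IsPositive) : ∑' ω, ptr (I ω ρ).1 = ptr ρ.1 := by
  have h1 := h.2 ρ
  have h2 := fun ω => (h.1 ω).isPositive ρ hρ
  simp only [trace_eq_ptr _ hρ, trace_eq_ptr _ (h2 _)] at h1
  have h3 := Complex.hasSum_ofReal.1 h1
  have h4 := ENNReal.ofReal_tsum_of_nonneg (fun ω => ENNReal.toReal_nonneg) h3.summable
  rw [h3.tsum_eq, ENNReal.ofReal_toReal (ptr_ne_top hρ ρ.2)] at h4
  rw [h4]
  exact tsum_congr fun ω => (ENNReal.ofReal_toReal (ptr_ne_top (h2 ω) (I ω ρ).2)).symm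

theorem isInstrument_of_ptr {Ω : Type*} {I : Ω → Op H K} (h : ∀ ω, IsCP (I ω))
    (h2 : ∀ ρ : traceClass H, ρ.1.IsPositive → ∑' ω, ptr (I ω ρ).1 = ptr ρ.1) :
    IsInstrument I := by
  refine ⟨h, fun ρ => ?_⟩
  simp only [← traceL_apply]
  induction ρ using traceClass_induction with
  | pos ρ hρ =>
    simp only [traceL_apply, trace_eq_ptr _ hρ, trace_eq_ptr _ ((h _).isPositive ρ hρ)]
    rw [Complex.hasSum_ofReal, ← h2 ρ hρ]
    have h3 : ∑' ω, ptr (I ω ρ).1 ≠ ∞ := h2 ρ hρ ▸ ptr_ne_top hρ ρ.2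
    rw [ENNReal.tsum_toReal_eq (ENNReal.ne_top_of_tsum_ne_top h3)]
    exact (ENNReal.summable_toReal h3).hasSum
  | add ρ σ h3 h4 => simpa only [map_add] using h3.add h4
  | smul c ρ h3 => simpa only [map_smul, smul_eq_mul] using h3.mul_left c

theorem IsInstrument.isBoundedPos {Ω : Type*} {I : Ω → Op H K} (h : IsInstrument I) (ω : Ω) :
    IsBoundedPos (I ω) 1 := fun ρ hρ =>
  ⟨(h.1 ω).isPositive ρ hρ, by
    rw [ENNReal.coe_one, one_mul, ← h.tsum_ptr ρ hρ]; exact ENNReal.le_tsum ω⟩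

theorem IsBoundedPos.comp {E : Op K L} {F : Op H K} {c d : ℝ≥0} (hE : IsBoundedPos E c)
    (hF : IsBoundedPos F d) : IsBoundedPos (E ∘ₗ F) (c * d) := fun ρ hρ => by
  obtain ⟨h1, h2⟩ := hF ρ hρ
  obtain ⟨h3, h4⟩ := hE _ h1
  refine ⟨h3, h4.trans ?_⟩
  rw [ENNReal.coe_mul, mul_assoc]
  gcongr

theorem IsBoundedPos.norm_trace_le {E : Op H K} {c : ℝ≥0} (hE : IsBoundedPos E c) (x : H) :
    ‖trace (E (ketbra x))‖ ≤ c * ‖x‖ ^ 2 := by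
  obtain ⟨h1, h2⟩ := hE _ (ketbra_isPositive x)
  rw [trace_eq_ptr _ h1, Complex.norm_real, Real.norm_of_nonneg ENNReal.toReal_nonneg]
  rw [ptr_ketbra] at h2
  have h3 := ENNReal.toReal_mono (ENNReal.mul_ne_top ENNReal.coe_ne_top (enorm_sq_ne_top x)) h2
  simpa using h3

theorem inner_ketbra (x y : H) : inner ℂ y ((ketbra x).1 y) = ((‖inner ℂ x y‖ₑ ^ 2).toReal : ℂ) := by
  rw [inner_eq_qf (ketbra_isPositive _)]
  have h5 := isDecomp_rankOne x y
  simp only [tsum_fintype, Finset.univ_unique, Finset.sum_const, Finset.card_singleton,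
    one_smul] at h5
  rw [h5]
  rfl

theorem IsDecomp.inner_sub_sum {ι : Type*} {T : H →L[ℂ] H} (hT : T.IsPositive) {ψ : ι → H}
    (hψ : IsDecomp T ψ) (s : Finset ι) (x : H) :
    inner ℂ x ((T - ∑ i ∈ s, (ketbra (ψ i)).1) x) =
      ((∑' i : {i // i ∉ s}, ‖inner ℂ (ψ i) x‖ₑ ^ 2).toReal : ℂ) := by
  have h3 : ∑ i ∈ s, ‖inner ℂ (ψ i) x‖ₑ ^ 2 + ∑' i : {i // i ∉ s}, ‖inner ℂ (ψ i) x‖ₑ ^ 2 =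
      qf T x := (ENNReal.sum_add_tsum_compl s fun i => ‖inner ℂ (ψ i) x‖ₑ ^ 2).trans (hψ x)
  have h6 : ∀ i ∈ s, ‖inner ℂ (ψ i) x‖ₑ ^ 2 ≠ ∞ := fun i _ => enorm_sq_ne_top _
  have h7 : ∑' i : {i // i ∉ s}, ‖inner ℂ (ψ i) x‖ₑ ^ 2 ≠ ∞ :=
    ne_top_of_le_ne_top (h3 ▸ qf_ne_top T x) le_add_self
  have h8 := congrArg (fun r : ℝ≥0∞ => (r.toReal : ℂ)) h3
  simp only [ENNReal.toReal_add (ENNReal.sum_ne_top.2 h6) h7, ENNReal.toReal_sum h6,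
    Complex.ofReal_add, Complex.ofReal_sum, ← inner_eq_qf hT] at h8
  rw [sub_apply, sum_apply, inner_sub_right, inner_sum,
    ← h8]
  simp only [inner_ketbra]
  ring

/-- Removing finitely many rank one terms leaves a positive remainder decomposed by the other
vectors; its trace is therefore the tail of a convergent series. -/
theorem IsDecomp.sub_sum {ι : Type*} {T : H →L[ℂ] H} (hT : T.IsPositive) {ψ : ι → H}
    (hψ : IsDecomp T ψ) (s : Finset ι) :
    (T - ∑ i ∈ s, (ketbra (ψ i)).1).IsPositive ∧
      IsDecomp (T - ∑ i ∈ s, (ketbra (ψ i)).1) fun i : {i // i ∉ s} => ψ i := by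
  constructor
  · rw [ContinuousLinearMap.isPositive_iff_complex]
    intro x
    have h3 := hψ.inner_sub_sum hT s x
    rw [← inner_conj_symm, h3, Complex.conj_ofReal]
    simp
  · intro x
    rw [qf, hψ.inner_sub_sum hT s x, Complex.ofReal_re, ENNReal.ofReal_toReal]
    refine ne_top_of_le_ne_top (qf_ne_top T x) ?_
    rw [← hψ x]
    exact ENNReal.tsum_comp_le_tsum_of_injective Subtype.val_injective
      fun i => ‖inner ℂ (ψ i) x‖ₑ ^ 2

/-- A bounded positive map is countably additive on decompositions into rank one operators. -/
theorem IsBoundedPos.hasSum_ketbra {E : Op H K} {c : ℝ≥0} (hE : IsBoundedPos E c) {ι : Type*}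
    {ρ : traceClass H} (hρ : ρ.1.IsPositive) {ψ : ι → H} (hψ : IsDecomp ρ.1 ψ) :
    HasSum (fun i => (E (ketbra (ψ i))).1) (E ρ).1 := by
  have hfin : ∑' i, ‖ψ i‖ₑ ^ 2 ≠ ∞ := hψ.ptr_eq ▸ ptr_ne_top hρ ρ.2
  -- The error is `E` of the positive remainder, so its norm is at most its trace, hence at most `c`
  -- times the tail.
  have key : ∀ s : Finset ι,
      edist (∑ i ∈ s, (E (ketbra (ψ i))).1) (E ρ).1 ≤ c * ∑' i : {i // i ∉ s}, ‖ψ i‖ₑ ^ 2 := by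
    intro s
    obtain ⟨hτ, hd⟩ := hψ.sub_sum hρ s
    have h9 : (ρ - ∑ i ∈ s, ketbra (ψ i) : traceClass H).1 =
      ρ.1 - ∑ i ∈ s, (ketbra (ψ i)).1 := by simp
    have h10 : (E (ρ - ∑ i ∈ s, ketbra (ψ i))).1 = (E ρ).1 - ∑ i ∈ s, (E (ketbra (ψ i))).1 := by
      simp [map_sub, map_sum]
    obtain ⟨h11, h12⟩ := hE (ρ - ∑ i ∈ s, ketbra (ψ i)) (h9 ▸ hτ)
    rw [edist_comm, edist_eq_enorm_sub, ← h10, ← hd.ptr_eq, ← h9]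
    exact (enorm_le_ptr h11).trans h12
  have ht := ENNReal.Tendsto.const_mul (ENNReal.tendsto_tsum_compl_atTop_zero hfin)
    (Or.inr (ENNReal.coe_ne_top (r := c)))
  rw [mul_zero] at ht
  rw [HasSum]
  exact tendsto_iff_edist_tendsto_0.2 (tendsto_of_tendsto_of_tendsto_of_le_of_le
    tendsto_const_nhds ht (fun _ => zero_le) key)

/-- Conjugation `ρ ↦ S ρ S*` by a bounded operator. -/
theorem conj_mem_traceClass (S : H →L[ℂ] K) {T : H →L[ℂ] H} (hT : T ∈ traceClass H) :
    S ∘L T ∘L adjoint S ∈ traceClass K := by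
  induction hT using Submodule.span_induction with
  | mem T h =>
    have hd := (isDecomp_sqrt h.1).conj S
    refine mem_traceClass_of_ptr (h.1.conj_adjoint S) ?_
    rw [hd.ptr_eq]
    have h1 : ∑' i, ‖S (CFC.sqrt T (basis H i))‖ₑ ^ 2 ≤ ‖S‖ₑ ^ 2 * ptr T := by
      rw [(isDecomp_sqrt h.1).ptr_eq, ← ENNReal.tsum_mul_left]
      refine ENNReal.tsum_le_tsum fun i => ?_
      rw [← mul_pow]
      gcongr
      exact S.le_opENorm _
    exact ne_top_of_le_ne_top (ENNReal.mul_ne_top (enorm_sq_ne_top S)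
      (ptr_ne_top h.1 (Submodule.subset_span h))) h1
  | zero => simp
  | add x y _ _ hx hy =>
    simpa [ContinuousLinearMap.add_comp, ContinuousLinearMap.comp_add] using add_mem hx hy
  | smul a x _ hx =>
    simpa [ContinuousLinearMap.smul_comp] using
      Submodule.smul_mem _ a hx

/-- The map `ρ ↦ S ρ S*` on trace class operators. -/
def conjOp (S : H →L[ℂ] K) : Op H K where
  toFun ρ := ⟨S ∘L ρ.1 ∘L adjoint S, conj_mem_traceClass S ρ.2⟩
  map_add' ρ σ := by
    ext1
    simp [ContinuousLinearMap.add_comp, ContinuousLinearMap.comp_add]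
  map_smul' c ρ := by
    ext1
    simp [ContinuousLinearMap.smul_comp]

theorem conjOp_apply (S : H →L[ℂ] K) (ρ : traceClass H) :
    (conjOp S ρ).1 = S ∘L ρ.1 ∘L adjoint S := rfl

theorem conjOp_ketbra (S : H →L[ℂ] K) (x : H) : conjOp S (ketbra x) = ketbra (S x) :=
  Subtype.ext (ketbra_map S x).symm

theorem conjOp_id : conjOp (ContinuousLinearMap.id ℂ H) = LinearMap.id := by
  ext ρ x
  have h : adjoint (ContinuousLinearMap.id ℂ H) = ContinuousLinearMap.id ℂ H :=
    ContinuousLinearMap.adjoint_one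
  simp [conjOp_apply, h]

theorem conjOp_isCP (S : H →L[ℂ] K) : IsCP (conjOp S) := by
  intro n ρ h ξ
  refine (h fun i => adjoint S (ξ i)).trans_eq ?_
  simp [conjOp_apply, ContinuousLinearMap.adjoint_inner_left]

theorem ptr_conjOp (S : H →L[ℂ] K) {ρ : traceClass H} {ι : Type*} {ψ : ι → H}
    (h : IsDecomp ρ.1 ψ) : ptr (conjOp S ρ).1 = ∑' i, ‖S (ψ i)‖ₑ ^ 2 :=
  (h.conj S).ptr_eq

theorem conjOp_isBoundedPos (S : H →L[ℂ] K) : IsBoundedPos (conjOp S) (‖S‖₊ ^ 2) := by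
  intro ρ hρ
  refine ⟨(conjOp_isCP S).isPositive ρ hρ, ?_⟩
  rw [ptr_conjOp S (isDecomp_sqrt hρ), (isDecomp_sqrt hρ).ptr_eq, ← ENNReal.tsum_mul_left]
  refine ENNReal.tsum_le_tsum fun i => ?_
  push_cast
  rw [← mul_pow]
  gcongr
  exact S.le_opENorm _

theorem IsCP.comp {E : Op K L} {F : Op H K} (hE : IsCP E) (hF : IsCP F) : IsCP (E ∘ₗ F) :=
  fun n ρ h => hE n _ (hF n ρ h)

theorem isCP_zero : IsCP (0 : Op H K) := fun n ρ _ ξ => by simp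

theorem isCP_of_hasSum {ι : Type*} {E : ι → Op H K} {F : Op H K} (hE : ∀ i, IsCP (E i))
    (h : ∀ ρ, HasSum (fun i => (E i ρ).1) (F ρ).1) : IsCP F := by
  intro n ρ hρ ξ
  have h1 : HasSum (fun k => ∑ i, ∑ j, inner ℂ (ξ i) ((E k (ρ i j)).1 (ξ j)))
      (∑ i, ∑ j, inner ℂ (ξ i) ((F (ρ i j)).1 (ξ j))) :=
    hasSum_sum fun i _ => hasSum_sum fun j _ =>
      ((h (ρ i j)).mapL (ContinuousLinearMap.apply ℂ K (ξ j))).mapL (innerSL ℂ (ξ i))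
  exact h1.nonneg fun k => hE k n ρ hρ ξ

/-- Performing an instrument and then a quantum operation depending on the outcome is a quantum
operation. -/
theorem exists_sum_comp {ι : Type*} {F : ι → Op H K} (hF : IsInstrument F) {P : ι → Op K L}
    (hP : ∀ k, IsTPCP (P k)) :
    ∃ C : Op H L, IsTPCP C ∧ ∀ ρ, HasSum (fun k => (P k (F k ρ)).1) (C ρ).1 := by
  have hpos : ∀ (ρ : traceClass H), ρ.1.IsPositive → ∀ k, (P k (F k ρ)).1.IsPositive :=
    fun ρ hρ k => (hP k).1.isPositive _ ((hF.1 k).isPositive ρ hρ)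
  have htr : ∀ (ρ : traceClass H), ρ.1.IsPositive → ∑' k, ptr (P k (F k ρ)).1 = ptr ρ.1 := by
    intro ρ hρ
    rw [← hF.tsum_ptr ρ hρ]
    exact tsum_congr fun k => (hP k).ptr_eq _ ((hF.1 k).isPositive ρ hρ)
  -- For positive `ρ` the traces of the terms add up to that of `ρ`, which gives norm convergence
  -- and a trace class limit; linearity extends this to all `ρ`.
  have hmem : ∀ ρ : traceClass H, Summable (fun k => (P k (F k ρ)).1) ∧
      ∑' k, (P k (F k ρ)).1 ∈ traceClass L := by
    intro ρ
    induction ρ using traceClass_induction with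
    | pos ρ hρ =>
      have h1 : Summable fun k => (P k (F k ρ)).1 :=
        summable_of_tsum_ptr (hpos ρ hρ) (htr ρ hρ ▸ ptr_ne_top hρ ρ.2)
      refine ⟨h1, mem_traceClass_of_ptr (isPositive_of_hasSum h1.hasSum (hpos ρ hρ)) ?_⟩
      rw [ptr_hasSum h1.hasSum (hpos ρ hρ), htr ρ hρ]
      exact ptr_ne_top hρ ρ.2
    | add ρ σ h1 h2 =>
      simp only [map_add, Submodule.coe_add]
      exact ⟨h1.1.add h2.1, (h1.1.tsum_add h2.1) ▸ add_mem h1.2 h2.2⟩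
    | smul c ρ h1 =>
      simp only [map_smul, Submodule.coe_smul]
      exact ⟨h1.1.const_smul c, (h1.1.tsum_const_smul c) ▸ Submodule.smul_mem _ c h1.2⟩
  let C : Op H L :=
    { toFun := fun ρ => ⟨∑' k, (P k (F k ρ)).1, (hmem ρ).2⟩
      map_add' := fun ρ σ => by
        ext1
        simpa using (hmem ρ).1.tsum_add (hmem σ).1
      map_smul' := fun c ρ => by
        ext1
        simpa using (hmem ρ).1.tsum_const_smul c }
  have hC : ∀ ρ, HasSum (fun k => (P k (F k ρ)).1) (C ρ).1 := fun ρ => (hmem ρ).1.hasSum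
  refine ⟨C, isTPCP_of_ptr (isCP_of_hasSum (E := fun k => P k ∘ₗ F k)
    (fun k => (hP k).1.comp (hF.1 k)) hC) fun ρ hρ => ?_, hC⟩
  rw [ptr_hasSum (hC ρ) (hpos ρ hρ), htr ρ hρ]

/-- A positive trace class operator is a countable sum of rank one operators. -/
theorem exists_nat_decomp {T : H →L[ℂ] H} (hT : T.IsPositive) (hT' : T ∈ traceClass H) :
    ∃ ψ : ℕ → H, IsDecomp T ψ := by
  classical
  have h1 : ∑' i, ‖CFC.sqrt T (basis H i)‖ₑ ^ 2 ≠ ∞ :=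
    (isDecomp_sqrt hT).ptr_eq ▸ ptr_ne_top hT hT'
  -- The basis may be uncountable, but a finite trace leaves only countably many nonzero vectors;
  -- numbering them by `ℕ` and padding by zero keeps the outcome sets countable.
  have h2 := Summable.countable_support_ennreal h1
  set s := Function.support fun i => ‖CFC.sqrt T (basis H i)‖ₑ ^ 2
  have : Countable s := h2
  obtain ⟨f, hf⟩ := exists_injective_nat s
  refine ⟨Function.extend f (fun i => CFC.sqrt T (basis H i)) 0, fun x => ?_⟩
  rw [← isDecomp_sqrt hT x]
  have h3 : ∑' i : s, ‖inner ℂ (CFC.sqrt T (basis H i)) x‖ₑ ^ 2 =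
      ∑' i, ‖inner ℂ (CFC.sqrt T (basis H i)) x‖ₑ ^ 2 := by
    apply tsum_subtype_eq_of_support_subset
      (f := fun i => ‖inner ℂ (CFC.sqrt T (basis H i)) x‖ₑ ^ 2)
    intro i hi h0
    apply hi
    have h4 : CFC.sqrt T (basis H i) = 0 := by simpa using h0
    simp [h4]
  rw [← h3, ← tsum_extend_zero hf]
  refine tsum_congr fun n => ?_
  by_cases hn : ∃ i, f i = n
  · obtain ⟨i, rfl⟩ := hn
    simp [hf.extend_apply]
  · rw [Function.extend_apply' _ _ _ hn, Function.extend_apply' _ _ _ hn]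
    simp

end Ops

/-! ### The Hilbert space tensor product and partial inner products -/

section Tensor

universe u v

variable {A A' A'' : Type u} {B B' B'' : Type v}
variable [NormedAddCommGroup A] [InnerProductSpace ℂ A]
variable [NormedAddCommGroup B] [InnerProductSpace ℂ B]
variable [NormedAddCommGroup A'] [InnerProductSpace ℂ A']
variable [NormedAddCommGroup B'] [InnerProductSpace ℂ B']
variable [NormedAddCommGroup A''] [InnerProductSpace ℂ A'']
variable [NormedAddCommGroup B''] [InnerProductSpace ℂ B'']

theorem inner_tens (a a' : A) (b b' : B) :
    inner ℂ (tens a b) (tens a' b') = inner ℂ a a' * inner ℂ b b' := by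
  rw [tens, tens, UniformSpace.Completion.inner_coe, TensorProduct.inner_tmul]

theorem norm_tens (a : A) (b : B) : ‖tens a b‖ = ‖a‖ * ‖b‖ := by
  rw [tens, UniformSpace.Completion.norm_coe, TensorProduct.norm_tmul]

theorem opTensor_tens (X : A →L[ℂ] A') (Y : B →L[ℂ] B') (a : A) (b : B) :
    opTensor X Y (tens a b) = tens (X a) (Y b) := by
  rw [opTensor, tens, ContinuousLinearMap.completion_apply_coe, TensorProduct.mapL_tmul, tens]

/-- The map `(a, b) ↦ a ⊗ b` into the Hilbert space tensor product. -/
def tensL (A B : Type*) [NormedAddCommGroup A] [InnerProductSpace ℂ A]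
    [NormedAddCommGroup B] [InnerProductSpace ℂ B] : A →L[ℂ] B →L[ℂ] HTensor A B :=
  (ContinuousLinearMap.compL ℂ B (A ⊗[ℂ] B) (HTensor A B)
    UniformSpace.Completion.toComplL) ∘L TensorProduct.mkL ℂ A B

theorem tensL_apply (a : A) (b : B) : tensL A B a b = tens a b := rfl

theorem htensor_clm_ext {E : Type*} [NormedAddCommGroup E] [NormedSpace ℂ E]
    {S T : HTensor A B →L[ℂ] E} (h : ∀ a b, S (tens a b) = T (tens a b)) : S = T := by
  ext x
  induction x using UniformSpace.Completion.induction_on with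
  | hp => exact isClosed_eq S.continuous T.continuous
  | ih x =>
    induction x using TensorProduct.induction_on with
    | zero => rw [UniformSpace.Completion.coe_zero, map_zero, map_zero]
    | tmul a b => exact h a b
    | add x y hx hy => rw [UniformSpace.Completion.coe_add, map_add, map_add, hx, hy]

theorem htensor_ext {x y : HTensor A B}
    (h : ∀ a b, inner ℂ (tens a b) x = inner ℂ (tens a b) y) : x = y := by
  have h1 : innerSL ℂ x = innerSL ℂ y := htensor_clm_ext fun a b => by
    rw [innerSL_apply_apply, innerSL_apply_apply, ← inner_conj_symm, h, inner_conj_symm]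
  exact ext_inner_right ℂ fun z => by simpa using DFunLike.congr_fun h1 z

theorem opTensor_comp (X : A →L[ℂ] A') (X' : A' →L[ℂ] A'') (Y : B →L[ℂ] B')
    (Y' : B' →L[ℂ] B'') :
    opTensor X' Y' ∘L opTensor X Y = opTensor (X' ∘L X) (Y' ∘L Y) :=
  htensor_clm_ext fun a b => by simp [opTensor_tens]

theorem opTensor_opTensor (X : A →L[ℂ] A') (X' : A' →L[ℂ] A'') (Y : B →L[ℂ] B')
    (Y' : B' →L[ℂ] B'') (x : HTensor A B) :
    opTensor X' Y' (opTensor X Y x) = opTensor (X' ∘L X) (Y' ∘L Y) x :=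
  DFunLike.congr_fun (opTensor_comp X X' Y Y') x

theorem opTensor_id :
    opTensor (ContinuousLinearMap.id ℂ A) (ContinuousLinearMap.id ℂ B) =
      ContinuousLinearMap.id ℂ (HTensor A B) :=
  htensor_clm_ext fun a b => by simp [opTensor_tens]

theorem opTensor_zero_left (Y : B →L[ℂ] B') : opTensor (0 : A →L[ℂ] A') Y = 0 :=
  htensor_clm_ext fun a b => by rw [opTensor_tens, ← tensL_apply]; simp

theorem opTensor_rankOne (a a' : A) (b b' : B) :
    opTensor (InnerProductSpace.rankOne ℂ a a') (InnerProductSpace.rankOne ℂ b b') =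
      InnerProductSpace.rankOne ℂ (tens a b) (tens a' b') :=
  htensor_clm_ext fun x y => by
    rw [opTensor_tens, InnerProductSpace.rankOne_apply, InnerProductSpace.rankOne_apply,
      InnerProductSpace.rankOne_apply, inner_tens, ← tensL_apply, ← tensL_apply]
    simp [smul_smul, mul_comm]

variable [CompleteSpace A] [CompleteSpace B] [CompleteSpace A'] [CompleteSpace B']
  [CompleteSpace A''] [CompleteSpace B'']

theorem opTensor_ketbra (a : A) (b : B) :
    opTensor (ketbra a).1 (ketbra b).1 = (ketbra (tens a b)).1 := opTensor_rankOne a a b b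

theorem adjoint_opTensor (X : A →L[ℂ] A') (Y : B →L[ℂ] B') :
    adjoint (opTensor X Y) = opTensor (adjoint X) (adjoint Y) :=
  htensor_clm_ext fun a b => htensor_ext fun a' b' => by
    simp [ContinuousLinearMap.adjoint_inner_right, opTensor_tens, inner_tens]

/-- The partial inner product `⟪b, ·⟫ : A ⊗ B → A`. -/
def sliceA (A : Type*) [NormedAddCommGroup A] [InnerProductSpace ℂ A] [CompleteSpace A] (b : B) :
    HTensor A B →L[ℂ] A :=
  adjoint ((tensL A B).flip b)

/-- The partial inner product `⟪a, ·⟫ : A ⊗ B → B`. -/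
def sliceB (B : Type*) [NormedAddCommGroup B] [InnerProductSpace ℂ B] [CompleteSpace B] (a : A) :
    HTensor A B →L[ℂ] B :=
  adjoint (tensL A B a)

omit [CompleteSpace B] in
theorem inner_sliceA (a : A) (b : B) (x : HTensor A B) :
    inner ℂ a (sliceA A b x) = inner ℂ (tens a b) x := by
  rw [sliceA, ContinuousLinearMap.adjoint_inner_right]
  rfl

omit [CompleteSpace A] in
theorem inner_sliceB (a : A) (b : B) (x : HTensor A B) :
    inner ℂ b (sliceB B a x) = inner ℂ (tens a b) x := by
  rw [sliceB, ContinuousLinearMap.adjoint_inner_right]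
  rfl

omit [CompleteSpace B] in
theorem sliceA_tens (a : A) (b b' : B) : sliceA A b (tens a b') = inner ℂ b b' • a :=
  ext_inner_left ℂ fun x => by
    rw [inner_sliceA, inner_tens, inner_smul_right, mul_comm]

omit [CompleteSpace A] in
theorem sliceB_tens (a a' : A) (b : B) : sliceB B a (tens a' b) = inner ℂ a a' • b :=
  ext_inner_left ℂ fun x => by
    rw [inner_sliceB, inner_tens, inner_smul_right]

omit [CompleteSpace B] in
theorem adjoint_sliceA (a : A) (b : B) : adjoint (sliceA A b) a = tens a b := by
  rw [sliceA, ContinuousLinearMap.adjoint_adjoint]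
  rfl

omit [CompleteSpace A] in
theorem adjoint_sliceB (a : A) (b : B) : adjoint (sliceB B a) b = tens a b := by
  rw [sliceB, ContinuousLinearMap.adjoint_adjoint]
  rfl

theorem sliceA_opTensor (X : A →L[ℂ] A') (Y : B →L[ℂ] B') (b : B') (x : HTensor A B) :
    sliceA A' b (opTensor X Y x) = X (sliceA A (adjoint Y b) x) :=
  ext_inner_left ℂ fun a => by
    rw [inner_sliceA, ← ContinuousLinearMap.adjoint_inner_left, adjoint_opTensor, opTensor_tens,
      ← ContinuousLinearMap.adjoint_inner_left X, inner_sliceA]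

theorem sliceB_opTensor (X : A →L[ℂ] A') (Y : B →L[ℂ] B') (a : A') (x : HTensor A B) :
    sliceB B' a (opTensor X Y x) = Y (sliceB B (adjoint X a) x) :=
  ext_inner_left ℂ fun b => by
    rw [inner_sliceB, ← ContinuousLinearMap.adjoint_inner_left, adjoint_opTensor, opTensor_tens,
      ← ContinuousLinearMap.adjoint_inner_left Y, inner_sliceB]

omit [CompleteSpace B] in
theorem ext_sliceA {x y : HTensor A B} (h : ∀ b : B, sliceA A b x = sliceA A b y) : x = y :=
  htensor_ext fun a b => by rw [← inner_sliceA, h, inner_sliceA]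

omit [CompleteSpace A] in
theorem ext_sliceB {x y : HTensor A B} (h : ∀ a : A, sliceB B a x = sliceB B a y) : x = y :=
  htensor_ext fun a b => by rw [← inner_sliceB, h, inner_sliceB]

/-- The product of two Hilbert bases is a Hilbert basis of the tensor product. -/
def prodBasis {ι κ : Type*} (e : HilbertBasis ι ℂ A) (f : HilbertBasis κ ℂ B) :
    HilbertBasis (ι × κ) ℂ (HTensor A B) :=
  HilbertBasis.mkOfOrthogonalEqBot (v := fun i => tens (e i.1) (f i.2))
    (by
      classical
      have h := Orthonormal.tmul e.orthonormal f.orthonormal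
      rw [orthonormal_iff_ite] at h ⊢
      intro i j
      rw [← h i j, tens, tens, UniformSpace.Completion.inner_coe])
    (by
      rw [Submodule.eq_bot_iff]
      intro x hx
      -- For `x` orthogonal to all products of basis vectors, Parseval in `A` kills the slices along
      -- each `f j`, and then Parseval in `B` kills the slices along every `a`.
      have h1 : ∀ i j, inner ℂ (tens (e i) (f j)) x = 0 := fun i j =>
        (Submodule.mem_orthogonal _ _).1 hx _ (Submodule.subset_span ⟨(i, j), rfl⟩)
      have h2 : ∀ j, sliceA A (f j) x = 0 := fun j => by
        rw [← enorm_eq_zero, ← pow_eq_zero_iff two_ne_zero, ← tsum_enorm_inner_sq e]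
        simp [inner_sliceA, h1]
      refine ext_sliceB fun a => ?_
      rw [map_zero, ← enorm_eq_zero, ← pow_eq_zero_iff two_ne_zero, ← tsum_enorm_inner_sq f]
      simp [inner_sliceB, ← inner_sliceA, h2])

theorem prodBasis_apply {ι κ : Type*} (e : HilbertBasis ι ℂ A) (f : HilbertBasis κ ℂ B)
    (i : ι × κ) : prodBasis e f i = tens (e i.1) (f i.2) := by
  rw [prodBasis, HilbertBasis.coe_mkOfOrthogonalEqBot]

theorem tsum_sliceA (x : HTensor A B) :
    ∑' j, ‖sliceA A (basis B j) x‖ₑ ^ 2 = ‖x‖ₑ ^ 2 := by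
  rw [← tsum_enorm_inner_sq (prodBasis (basis A) (basis B)), ENNReal.tsum_prod', ENNReal.tsum_comm]
  simp only [prodBasis_apply, ← inner_sliceA, tsum_enorm_inner_sq]

theorem tsum_sliceB (x : HTensor A B) :
    ∑' j, ‖sliceB B (basis A j) x‖ₑ ^ 2 = ‖x‖ₑ ^ 2 := by
  rw [← tsum_enorm_inner_sq (prodBasis (basis A) (basis B)), ENNReal.tsum_prod']
  simp only [prodBasis_apply, ← inner_sliceB, tsum_enorm_inner_sq]

/-- An inequality `∑ Yᵢ* Yᵢ ≤ X* X` is preserved by tensoring with the identity of `B`. -/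
theorem tsum_opTensor_left_le {ι : Type*} {Y : ι → A →L[ℂ] A''}
    {X : A →L[ℂ] A'} (h : ∀ a, ∑' i, ‖Y i a‖ₑ ^ 2 ≤ ‖X a‖ₑ ^ 2) (x : HTensor A B) :
    ∑' i, ‖opTensor (Y i) (ContinuousLinearMap.id ℂ B) x‖ₑ ^ 2 ≤
      ‖opTensor X (ContinuousLinearMap.id ℂ B) x‖ₑ ^ 2 := by
  have h1 : adjoint (ContinuousLinearMap.id ℂ B) = ContinuousLinearMap.id ℂ B :=
    ContinuousLinearMap.adjoint_one
  simp only [← tsum_sliceA (opTensor _ _ x), sliceA_opTensor, h1]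
  rw [ENNReal.tsum_comm]
  exact ENNReal.tsum_le_tsum fun j => h _

theorem tsum_opTensor_left_eq {ι : Type*} {Y : ι → A →L[ℂ] A''}
    {X : A →L[ℂ] A'} (h : ∀ a, ∑' i, ‖Y i a‖ₑ ^ 2 = ‖X a‖ₑ ^ 2) (x : HTensor A B) :
    ∑' i, ‖opTensor (Y i) (ContinuousLinearMap.id ℂ B) x‖ₑ ^ 2 =
      ‖opTensor X (ContinuousLinearMap.id ℂ B) x‖ₑ ^ 2 := by
  have h1 : adjoint (ContinuousLinearMap.id ℂ B) = ContinuousLinearMap.id ℂ B :=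
    ContinuousLinearMap.adjoint_one
  simp only [← tsum_sliceA (opTensor _ _ x), sliceA_opTensor, h1]
  rw [ENNReal.tsum_comm]
  exact tsum_congr fun j => h _

end Tensor

/-! ### Polarization and the operators `|x⟩⟨y|` -/

section Polarization

/-- A sesquilinear form that vanishes on the diagonal is zero. -/
theorem sesq_eq_zero {V : Type*} [AddCommGroup V] [Module ℂ V] {f : V → V → ℂ}
    (add_left : ∀ x y z, f (x + y) z = f x z + f y z) (smul_left : ∀ (c : ℂ) x z, f (c • x) z = c * f x z)
    (add_right : ∀ x y z, f x (y + z) = f x y + f x z)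
    (smul_right : ∀ (c : ℂ) x z, f x (c • z) = starRingEnd ℂ c * f x z)
    (h : ∀ x, f x x = 0) (x y : V) : f x y = 0 := by
  have h1 := h (x + y)
  have h2 := h (x + Complex.I • y)
  simp only [add_left, add_right, smul_left, smul_right, h, Complex.conj_I] at h1 h2
  have h3 : f y x = - f x y := by linear_combination h1
  rw [h3] at h2
  have h4 : (-2 * Complex.I) * f x y = 0 := by linear_combination h2
  simpa using h4

variable {H : Type*} [NormedAddCommGroup H] [InnerProductSpace ℂ H] [CompleteSpace H]

theorem rankOne_mem_traceClass (x y : H) : InnerProductSpace.rankOne ℂ x y ∈ traceClass H := by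
  have h : InnerProductSpace.rankOne ℂ x y = (1 / 4 : ℂ) • ((ketbra (x + y)).1 -
      (ketbra (x - y)).1 + Complex.I • (ketbra (x + Complex.I • y)).1 -
      Complex.I • (ketbra (x - Complex.I • y)).1) := by
    ext z
    simp only [ketbra, InnerProductSpace.rankOne_apply, smul_apply, sub_apply, add_apply,
      inner_add_left, inner_sub_left, inner_smul_left, Complex.conj_I]
    match_scalars <;> (ring_nf; simp [Complex.I_sq]; try ring)
  rw [h]
  exact Submodule.smul_mem _ _ (sub_mem (add_mem (sub_mem (ketbra _).2 (ketbra _).2)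
    (Submodule.smul_mem _ _ (ketbra _).2)) (Submodule.smul_mem _ _ (ketbra _).2))

/-- The rank one operator `|x⟩⟨y|`. -/
def crossKet (x y : H) : traceClass H :=
  ⟨InnerProductSpace.rankOne ℂ x y, rankOne_mem_traceClass x y⟩

theorem crossKet_self (x : H) : crossKet x x = ketbra x := rfl

theorem crossKet_add_left (x y z : H) : crossKet (x + y) z = crossKet x z + crossKet y z :=
  Subtype.ext (by simp [crossKet])

theorem crossKet_add_right (x y z : H) : crossKet x (y + z) = crossKet x y + crossKet x z :=
  Subtype.ext (by simp [crossKet])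

theorem crossKet_smul_left (c : ℂ) (x z : H) : crossKet (c • x) z = c • crossKet x z :=
  Subtype.ext (by simp [crossKet])

theorem crossKet_smul_right (c : ℂ) (x z : H) :
    crossKet x (c • z) = starRingEnd ℂ c • crossKet x z :=
  Subtype.ext (by simp [crossKet])

theorem four_crossKet (x y : H) : (4 : ℂ) • crossKet x y = ketbra (x + y) - ketbra (x - y) +
    Complex.I • ketbra (x + Complex.I • y) - Complex.I • ketbra (x - Complex.I • y) := by
  simp only [← crossKet_self, sub_eq_add_neg, ← neg_one_smul ℂ y,
    ← neg_one_smul ℂ (Complex.I • y), crossKet_add_left, crossKet_add_right, crossKet_smul_left,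
    crossKet_smul_right, smul_add, smul_smul, Complex.conj_I, map_neg, map_one]
  match_scalars <;> ring_nf <;> simp [Complex.I_sq] <;> ring

theorem norm_crossKet_le {τ : traceClass H →ₗ[ℂ] ℂ} {c : ℝ} (hc : 0 ≤ c)
    (hτ : ∀ x, ‖τ (ketbra x)‖ ≤ c * ‖x‖ ^ 2) (x y : H) :
    ‖τ (crossKet x y)‖ ≤ 4 * c * ‖y‖ * ‖x‖ := by
  -- For unit vectors the four vectors in the polarization identity have norm at most `2`, so each
  -- term is at most `4 * c`; dividing the sum of four by `4` leaves `4 * c`. Homogeneity does the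
  -- rest.
  have key : ∀ x y : H, ‖x‖ = 1 → ‖y‖ = 1 → ‖τ (crossKet x y)‖ ≤ 4 * c := by
    intro x y hx hy
    have h1 := congrArg τ (four_crossKet x y)
    simp only [map_smul, map_sub, map_add, smul_eq_mul] at h1
    have h2 : ∀ z : H, ‖z‖ ≤ 2 → ‖τ (ketbra z)‖ ≤ 4 * c := fun z hz => by
      refine (hτ z).trans ?_
      nlinarith [norm_nonneg z, mul_le_mul hz hz (norm_nonneg z) zero_le_two]
    have hiy : ‖Complex.I • y‖ = 1 := by rw [norm_smul, hy]; simp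
    have h3 := h2 (x + y) ((norm_add_le _ _).trans (by linarith))
    have h4 := h2 (x - y) ((norm_sub_le _ _).trans (by linarith))
    have h5 := h2 (x + Complex.I • y) ((norm_add_le _ _).trans (by linarith))
    have h6 := h2 (x - Complex.I • y) ((norm_sub_le _ _).trans (by linarith))
    have h7 : ‖(4 : ℂ) * τ (crossKet x y)‖ ≤ 4 * c + 4 * c + 4 * c + 4 * c := by
      rw [h1]
      refine (norm_sub_le _ _).trans (add_le_add ((norm_add_le _ _).trans
        (add_le_add ((norm_sub_le _ _).trans (add_le_add h3 h4)) ?_)) ?_)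
      · simpa using h5
      · simpa using h6
    rw [norm_mul] at h7
    norm_num at h7
    linarith
  by_cases hx : x = 0
  · have h0 : crossKet (0 : H) y = 0 := by simpa using crossKet_smul_left 0 (0 : H) y
    simp [hx, h0]
  by_cases hy : y = 0
  · have h0 : crossKet x (0 : H) = 0 := by simpa using crossKet_smul_right 0 x (0 : H)
    simp [hy, h0]
  have hx' : ((‖x‖ : ℝ) : ℂ) • (((‖x‖ : ℝ) : ℂ)⁻¹ • x) = x :=
    smul_inv_smul₀ (by simpa using hx) x
  have hy' : ((‖y‖ : ℝ) : ℂ) • (((‖y‖ : ℝ) : ℂ)⁻¹ • y) = y :=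
    smul_inv_smul₀ (by simpa using hy) y
  have h1 := key (((‖x‖ : ℝ) : ℂ)⁻¹ • x) (((‖y‖ : ℝ) : ℂ)⁻¹ • y)
    (by rw [norm_smul]; simp [hx]) (by rw [norm_smul]; simp [hy])
  rw [← hx', ← hy', crossKet_smul_left, crossKet_smul_right, hx', hy', map_smul, map_smul,
    norm_smul, norm_smul, RCLike.norm_conj, Complex.norm_real, Complex.norm_real, norm_norm,
    norm_norm]
  calc _ ≤ ‖x‖ * (‖y‖ * (4 * c)) := by gcongr
    _ = _ := by ring

end Polarization

/-! ### From product vectors to all vectors; no signalling -/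

section Extension

universe u v
variable {A : Type u} {B : Type v} [NormedAddCommGroup A] [InnerProductSpace ℂ A]
variable [NormedAddCommGroup B] [InnerProductSpace ℂ B]

/-- A bounded functional on the trace class that vanishes on product vector states vanishes on all
vector states. -/
theorem eq_zero_of_tens {τ : traceClass (HTensor A B) →ₗ[ℂ] ℂ} {c : ℝ} (hc : 0 ≤ c)
    (hτ : ∀ x, ‖τ (ketbra x)‖ ≤ c * ‖x‖ ^ 2) (h : ∀ a b, τ (ketbra (tens a b)) = 0)
    (x : HTensor A B) : τ (ketbra x) = 0 := by
  -- Polarization is applied in the `A` factor first and then in the `B` factor.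
  have h1 : ∀ a a' b, τ (crossKet (tens a b) (tens a' b)) = 0 := by
    intro a a' b
    refine sesq_eq_zero (f := fun a a' => τ (crossKet (tens a b) (tens a' b)))
      ?_ ?_ ?_ ?_ (fun a => h a b) a a' <;> intros <;>
      simp only [← tensL_apply, map_add, map_smul, add_apply, smul_apply, crossKet_add_left,
        crossKet_add_right, crossKet_smul_left, crossKet_smul_right, smul_eq_mul]
  have h2 : ∀ a a' b b', τ (crossKet (tens a b) (tens a' b')) = 0 := by
    intro a a' b b'
    refine sesq_eq_zero (f := fun b b' => τ (crossKet (tens a b) (tens a' b')))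
      ?_ ?_ ?_ ?_ (fun b => h1 a a' b) b b' <;> intros <;>
      simp only [← tensL_apply, map_add, map_smul, crossKet_add_left,
        crossKet_add_right, crossKet_smul_left, crossKet_smul_right, smul_eq_mul]
  -- By `norm_crossKet_le` the form `τ (|x⟩⟨y|)` is continuous in each slot, so vanishing passes
  -- from product vectors to the completion one slot at a time.
  let s (y : HTensor A B) : HTensor A B →L[ℂ] ℂ := LinearMap.mkContinuous
    { toFun := fun x => τ (crossKet x y)
      map_add' := fun _ _ => by rw [crossKet_add_left, map_add]
      map_smul' := fun _ _ => by rw [crossKet_smul_left, map_smul]; rfl }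
    (4 * c * ‖y‖) (fun x => norm_crossKet_le hc hτ x y)
  let s' (x : HTensor A B) : HTensor A B →L[ℂ] ℂ := LinearMap.mkContinuous
    { toFun := fun y => starRingEnd ℂ (τ (crossKet x y))
      map_add' := fun _ _ => by rw [crossKet_add_right, map_add, map_add]
      map_smul' := fun _ _ => by rw [crossKet_smul_right, map_smul]; simp }
    (4 * c * ‖x‖) (fun y => by
      simpa [mul_assoc, mul_comm, mul_left_comm] using norm_crossKet_le hc hτ x y)
  have h3 : ∀ a b x, τ (crossKet x (tens a b)) = 0 := fun a b x =>
    DFunLike.congr_fun (htensor_clm_ext (S := s (tens a b)) (T := 0) fun a' b' => h2 a' a b' b) x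
  have h4 := DFunLike.congr_fun (htensor_clm_ext (S := s' x) (T := 0) fun a b => by
    simp [s', h3]) x
  simpa [s', crossKet_self] using h4

variable [CompleteSpace A] [CompleteSpace B]
variable {A₁ : Type u} {B₁ : Type v} [NormedAddCommGroup A₁] [InnerProductSpace ℂ A₁]
  [CompleteSpace A₁] [NormedAddCommGroup B₁] [InnerProductSpace ℂ B₁] [CompleteSpace B₁]

omit [CompleteSpace A] [CompleteSpace B] in
-- `IsTensorOp` prescribes a map on product states only; this carries identities between traces over
-- to entangled vectors.
theorem eq_of_tens {H K : Type*} [NormedAddCommGroup H] [InnerProductSpace ℂ H] [CompleteSpace H]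
    [NormedAddCommGroup K] [InnerProductSpace ℂ K] [CompleteSpace K]
    {E : Op (HTensor A B) H} {G : Op (HTensor A B) K} {c d : ℝ≥0} (hE : IsBoundedPos E c)
    (hG : IsBoundedPos G d)
    (h : ∀ a b, trace (E (ketbra (tens a b))) = trace (G (ketbra (tens a b))))
    (x : HTensor A B) : trace (E (ketbra x)) = trace (G (ketbra x)) := by
  have h1 := eq_zero_of_tens (τ := traceL H ∘ₗ E - traceL K ∘ₗ G) (c := c + d) (by positivity)
    (fun x => by
      rw [add_mul]
      exact (norm_sub_le _ _).trans (add_le_add (hE.norm_trace_le x) (hG.norm_trace_le x)))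
    (fun a b => by simp [h]) x
  simpa [sub_eq_zero] using h1

theorem ptr_eq_of_trace_eq {H K : Type*} [NormedAddCommGroup H] [InnerProductSpace ℂ H]
    [CompleteSpace H] [NormedAddCommGroup K] [InnerProductSpace ℂ K] [CompleteSpace K]
    {ρ : traceClass H} {σ : traceClass K} (hρ : ρ.1.IsPositive) (hσ : σ.1.IsPositive)
    (h : trace ρ = trace σ) : ptr ρ.1 = ptr σ.1 := by
  rw [trace_eq_ptr _ hρ, trace_eq_ptr _ hσ] at h
  exact (ENNReal.toReal_eq_toReal_iff' (ptr_ne_top hρ ρ.2) (ptr_ne_top hσ σ.2)).1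
    (by exact_mod_cast h)

/-- An operation of Alice commutes with a partial inner product on Bob's side (traced). -/
theorem IsTensorOp.ptr_sliceA {F : Op (HTensor A B) (HTensor A₁ B)} {J : Op A A₁} {c d : ℝ≥0}
    (h : IsTensorOp F J LinearMap.id) (hF : IsBoundedPos F c) (hJ : IsBoundedPos J d) (b : B)
    (x : HTensor A B) :
    ptr (conjOp (sliceA A₁ b) (F (ketbra x))).1 = ptr (J (ketbra (sliceA A b x))).1 := by
  have h1 := (conjOp_isBoundedPos (sliceA A₁ b)).comp hF
  have h2 := hJ.comp (conjOp_isBoundedPos (sliceA A b))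
  rw [← conjOp_ketbra]
  -- On a product vector `a ⊗ b'` both operators equal `|⟨b, b'⟩|² J(|a⟩⟨a|)`.
  refine ptr_eq_of_trace_eq (h1 _ (ketbra_isPositive x)).1 (h2 _ (ketbra_isPositive x)).1
    (eq_of_tens h1 h2 (fun a b' => ?_) x)
  congr 1
  ext y
  rw [LinearMap.comp_apply, LinearMap.comp_apply, conjOp_ketbra, sliceA_tens, conjOp_apply, h.2]
  have h3 : ketbra (inner ℂ b b' • a) = (inner ℂ b b' * inner ℂ b' b) • ketbra a := by
    rw [← crossKet_self, crossKet_smul_left, crossKet_smul_right, smul_smul, inner_conj_symm,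
      crossKet_self]
  rw [h3, map_smul]
  have h4 : (ketbra b').1 b = inner ℂ b' b • b' := rfl
  simp only [LinearMap.id_apply, ContinuousLinearMap.comp_apply, adjoint_sliceA, opTensor_tens, h4,
    sliceA_tens, inner_smul_right, Submodule.coe_smul, smul_apply, mul_comm]

theorem IsTensorOp.ptr_sliceB {F : Op (HTensor A B) (HTensor A B₁)} {J : Op B B₁} {c d : ℝ≥0}
    (h : IsTensorOp F LinearMap.id J) (hF : IsBoundedPos F c) (hJ : IsBoundedPos J d) (a : A)
    (x : HTensor A B) :
    ptr (conjOp (sliceB B₁ a) (F (ketbra x))).1 = ptr (J (ketbra (sliceB B a x))).1 := by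
  have h1 := (conjOp_isBoundedPos (sliceB B₁ a)).comp hF
  have h2 := hJ.comp (conjOp_isBoundedPos (sliceB B a))
  rw [← conjOp_ketbra]
  refine ptr_eq_of_trace_eq (h1 _ (ketbra_isPositive x)).1 (h2 _ (ketbra_isPositive x)).1
    (eq_of_tens h1 h2 (fun a' b => ?_) x)
  congr 1
  ext y
  rw [LinearMap.comp_apply, LinearMap.comp_apply, conjOp_ketbra, sliceB_tens, conjOp_apply, h.2]
  have h3 : ketbra (inner ℂ a a' • b) = (inner ℂ a a' * inner ℂ a' a) • ketbra b := by
    rw [← crossKet_self, crossKet_smul_left, crossKet_smul_right, smul_smul, inner_conj_symm,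
      crossKet_self]
  rw [h3, map_smul]
  have h4 : (ketbra a').1 a = inner ℂ a' a • a' := rfl
  simp only [LinearMap.id_apply, ContinuousLinearMap.comp_apply, adjoint_sliceB, opTensor_tens, h4,
    sliceB_tens, inner_smul_right, Submodule.coe_smul, smul_apply, mul_comm]

/-- No signalling: an instrument of Alice does not change the reduced state of Bob. -/
theorem IsLocalAlice.tsum_sliceA {F : ℕ → Op (HTensor A B) (HTensor A₁ B)} (hF : IsLocalAlice F)
    (x : HTensor A B) {ι : ℕ → Type*} {ψ : ∀ k, ι k → HTensor A₁ B}
    (hψ : ∀ k, IsDecomp (F k (ketbra x)).1 (ψ k)) (b : B) :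
    ∑' k, ∑' j, ‖sliceA A₁ b (ψ k j)‖ₑ ^ 2 = ‖sliceA A b x‖ₑ ^ 2 := by
  obtain ⟨h1, J, h2, h3⟩ := hF
  rw [← ptr_ketbra, ← h2.tsum_ptr _ (ketbra_isPositive _)]
  refine tsum_congr fun k => ?_
  rw [← (h3 k).ptr_sliceA (h1.isBoundedPos k) (h2.isBoundedPos k), ptr_conjOp _ (hψ k)]

theorem IsLocalBob.tsum_sliceB {F : ℕ → Op (HTensor A B) (HTensor A B₁)} (hF : IsLocalBob F)
    (x : HTensor A B) {ι : ℕ → Type*} {ψ : ∀ k, ι k → HTensor A B₁}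
    (hψ : ∀ k, IsDecomp (F k (ketbra x)).1 (ψ k)) (a : A) :
    ∑' k, ∑' j, ‖sliceB B₁ a (ψ k j)‖ₑ ^ 2 = ‖sliceB B a x‖ₑ ^ 2 := by
  obtain ⟨h1, J, h2, h3⟩ := hF
  rw [← ptr_ketbra, ← h2.tsum_ptr _ (ketbra_isPositive _)]
  refine tsum_congr fun k => ?_
  rw [← (h3 k).ptr_sliceB (h1.isBoundedPos k) (h2.isBoundedPos k), ptr_conjOp _ (hψ k)]

end Extension

/-! ### Douglas' lemma and polar decomposition -/

section Factorization

variable {H K L : Type*} [NormedAddCommGroup H] [InnerProductSpace ℂ H] [CompleteSpace H]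
  [NormedAddCommGroup K] [InnerProductSpace ℂ K] [CompleteSpace K]
  [NormedAddCommGroup L] [InnerProductSpace ℂ L] [CompleteSpace L]

omit [CompleteSpace H] in
theorem inner_self_eq_ofReal (x : H) : inner ℂ x x = ((‖x‖ ^ 2 : ℝ) : ℂ) := by
  rw [inner_self_eq_norm_sq_to_K]
  norm_cast

/-- Douglas' lemma: if `‖T e‖ ≤ ‖R e‖` for all `e` then `T = C R` for a contraction `C`. -/
theorem exists_contraction_comp_eq {E : Type*} [AddCommGroup E] [Module ℂ E] {R : E →ₗ[ℂ] H}
    {T : E →ₗ[ℂ] K} (h : ∀ e, ‖T e‖ ≤ ‖R e‖) :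
    ∃ C : H →L[ℂ] K, (∀ x, ‖C x‖ ≤ ‖x‖) ∧ ∀ e, C (R e) = T e := by
  let M : Submodule ℂ H := (LinearMap.range R).topologicalClosure
  have : CompleteSpace M := (Submodule.isClosed_topologicalClosure _).completeSpace_coe
  let R' : E →ₗ[ℂ] M := R.codRestrict M fun e =>
    Submodule.le_topologicalClosure _ (LinearMap.mem_range_self R e)
  have hd : DenseRange R' := by
    intro x
    rw [closure_subtype]
    have h1 : Subtype.val '' Set.range R' = (LinearMap.range R : Set H) := by
      rw [← Set.range_comp]
      rfl
    rw [h1]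
    exact x.2
  have hb : ∀ e, ‖T e‖ ≤ 1 * ‖R' e‖ := fun e => by simpa [R'] using h e
  -- `R e ↦ T e` is contractive on the range of `R`; it extends to the closure `M` by continuity and
  -- by zero to the orthogonal complement.
  refine ⟨T.extendOfNorm R' ∘L M.orthogonalProjectionOnto, fun x => ?_, fun e => ?_⟩
  · refine (LinearMap.norm_extendOfNorm_apply_le hd 1 hb _).trans ?_
    rw [one_mul]
    exact M.norm_orthogonalProjectionOnto_apply_le x
  · have h1 : M.orthogonalProjectionOnto (R e) = R' e :=
      M.orthogonalProjectionOnto_mem_subspace_eq_self (R' e)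
    rw [ContinuousLinearMap.comp_apply, h1, LinearMap.extendOfNorm_eq hd ⟨1, hb⟩]

omit [CompleteSpace K] in
/-- The column operator `x ↦ (Yᵢ x)ᵢ` into the Hilbert sum. -/
theorem exists_column {ι E : Type*} [AddCommGroup E] [Module ℂ E] (Y : ι → E →ₗ[ℂ] K)
    (h : ∀ x, ∑' i, ‖Y i x‖ₑ ^ 2 ≠ ∞) :
    ∃ T : E →ₗ[ℂ] lp (fun _ : ι => K) 2, (∀ x i, T x i = Y i x) ∧
      ∀ x, ‖T x‖ₑ ^ 2 = ∑' i, ‖Y i x‖ₑ ^ 2 := by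
  have h1 : ∀ x, Memℓp (fun i => Y i x) 2 := by
    intro x
    rw [memℓp_gen_iff (by norm_num)]
    have h2 := ENNReal.summable_toReal (h x)
    simpa using h2
  let T : E →ₗ[ℂ] lp (fun _ : ι => K) 2 :=
    { toFun := fun x => ⟨fun i => Y i x, h1 x⟩
      map_add' := fun x y => by ext i; exact map_add (Y i) x y
      map_smul' := fun c x => by ext i; exact map_smul (Y i) c x }
  refine ⟨T, fun x i => rfl, fun x => ?_⟩
  have h3 := lp.norm_rpow_eq_tsum (p := 2) (by norm_num) (T x)
  have h4 : ‖T x‖ ^ 2 = ∑' i, ‖Y i x‖ ^ 2 := by simpa using! h3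
  rw [enorm_sq_eq_ofReal, h4, ENNReal.ofReal_tsum_of_nonneg (fun i => by positivity)
    (by simpa using ENNReal.summable_toReal (h x))]
  simp only [← enorm_sq_eq_ofReal]

omit [InnerProductSpace ℂ K] [CompleteSpace K] in
theorem tsum_enorm_lp {ι : Type*} (x : lp (fun _ : ι => K) 2) :
    ∑' i, ‖x i‖ₑ ^ 2 = ‖x‖ₑ ^ 2 := by
  have h3 := lp.norm_rpow_eq_tsum (p := 2) (by norm_num) x
  have h4 : ‖x‖ ^ 2 = ∑' i, ‖x i‖ ^ 2 := by simpa using! h3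
  have h5 : Summable fun i => ‖x i‖ ^ 2 := by simpa using (lp.memℓp x).summable (by norm_num)
  rw [enorm_sq_eq_ofReal, h4, ENNReal.ofReal_tsum_of_nonneg (fun i => by positivity) h5]
  simp only [← enorm_sq_eq_ofReal]

/-- Douglas' lemma for families: if `∑ Tᵢ* Tᵢ ≤ R* R` then `Tᵢ = Cᵢ R` with `∑ Cᵢ* Cᵢ ≤ 1`. -/
theorem exists_family_comp_eq {ι E : Type*} [AddCommGroup E] [Module ℂ E] {R : E →ₗ[ℂ] H}
    {T : ι → E →ₗ[ℂ] K} (h : ∀ e, ∑' i, ‖T i e‖ₑ ^ 2 ≤ ‖R e‖ₑ ^ 2) :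
    ∃ C : ι → H →L[ℂ] K, (∀ x, ∑' i, ‖C i x‖ₑ ^ 2 ≤ ‖x‖ₑ ^ 2) ∧ ∀ i e, C i (R e) = T i e := by
  obtain ⟨S, h1, h2⟩ := exists_column T fun e => ne_top_of_le_ne_top (enorm_sq_ne_top _) (h e)
  obtain ⟨C, h3, h4⟩ := exists_contraction_comp_eq (R := R) (T := S)
    fun e => norm_le_of_enorm_sq_le (h2 e ▸ h e)
  refine ⟨fun i => lp.evalCLM ℂ (fun _ : ι => K) 2 i ∘L C, fun x => ?_, fun i e => ?_⟩
  · refine (tsum_enorm_lp (C x)).trans_le ?_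
    gcongr
    rw [← ofReal_norm, ← ofReal_norm]
    exact ENNReal.ofReal_le_ofReal (h3 x)
  · rw [← h1, ← h4]
    rfl

/-- A family with `∑ Yᵢ* Yᵢ ≤ 1` is, up to isometry, a single operator. -/
theorem exists_sqrt_sum {ι : Type*} {Y : ι → H →L[ℂ] K} (h : ∀ x, ∑' i, ‖Y i x‖ₑ ^ 2 ≤ ‖x‖ₑ ^ 2) :
    ∃ X S : H →L[ℂ] H, (∀ x, ∑' i, ‖Y i x‖ₑ ^ 2 = ‖X x‖ₑ ^ 2) ∧
      ∀ x, ∑' i, ‖Y i x‖ₑ ^ 2 + ‖S x‖ₑ ^ 2 = ‖x‖ₑ ^ 2 := by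
  obtain ⟨T, h1, h2⟩ := exists_column (fun i => (Y i).toLinearMap) fun x =>
    ne_top_of_le_ne_top (enorm_sq_ne_top _) (h x)
  let T' : H →L[ℂ] lp (fun _ : ι => K) 2 := T.mkContinuous 1 fun x => by
    rw [one_mul]
    exact norm_le_of_enorm_sq_le (h2 x ▸ h x)
  have hT' : ∀ x, ‖T' x‖ₑ ^ 2 = ∑' i, ‖Y i x‖ₑ ^ 2 := h2
  have hp : (adjoint T' ∘L T').IsPositive := ContinuousLinearMap.isPositive_adjoint_comp_self T'
  have hin : ∀ x, inner ℂ x ((adjoint T' ∘L T') x) = ((‖T' x‖ ^ 2 : ℝ) : ℂ) := fun x => by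
    rw [ContinuousLinearMap.comp_apply, ContinuousLinearMap.adjoint_inner_right,
      inner_self_eq_ofReal]
  have hq : (ContinuousLinearMap.id ℂ H - adjoint T' ∘L T').IsPositive := by
    rw [ContinuousLinearMap.isPositive_iff_complex]
    intro x
    have h3 : inner ℂ ((ContinuousLinearMap.id ℂ H - adjoint T' ∘L T') x) x =
        ((‖x‖ ^ 2 - ‖T' x‖ ^ 2 : ℝ) : ℂ) := by
      rw [← inner_conj_symm, sub_apply, inner_sub_right, hin, ContinuousLinearMap.id_apply,
        inner_self_eq_ofReal, ← Complex.ofReal_sub, Complex.conj_ofReal]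
    have h4 : ‖T' x‖ ≤ ‖x‖ := norm_le_of_enorm_sq_le (hT' x ▸ h x)
    have h5 : 0 ≤ ‖x‖ ^ 2 - ‖T' x‖ ^ 2 := sub_nonneg.2 (by gcongr)
    rw [h3]
    generalize ‖x‖ ^ 2 - ‖T' x‖ ^ 2 = r at h5
    simp [h5]
  -- With `T'` the column of the `Y i`, these are `|T'|` and the defect operator `(1 - T'*
  -- T')^(1/2)`. Both act on `H` itself, whatever the target of the `Y i`.
  refine ⟨CFC.sqrt (adjoint T' ∘L T'), CFC.sqrt (ContinuousLinearMap.id ℂ H - adjoint T' ∘L T'),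
    fun x => ?_, fun x => ?_⟩
  · rw [← hT', ← qf_eq_sqrt hp, qf, hin, enorm_sq_eq_ofReal, Complex.ofReal_re]
  · rw [← hT', ← qf_eq_sqrt hq, qf, sub_apply, inner_sub_right, hin, ContinuousLinearMap.id_apply,
      inner_self_eq_ofReal, enorm_sq_eq_ofReal, enorm_sq_eq_ofReal, ← Complex.ofReal_sub,
      Complex.ofReal_re]
    have h4 : ‖T' x‖ ≤ ‖x‖ := norm_le_of_enorm_sq_le (hT' x ▸ h x)
    have h5 : 0 ≤ ‖x‖ ^ 2 - ‖T' x‖ ^ 2 := sub_nonneg.2 (by gcongr)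
    rw [← ENNReal.ofReal_add (by positivity) h5, add_sub_cancel]

theorem norm_sqrt_adjoint_comp_self (T : H →L[ℂ] K) (x : H) :
    ‖CFC.sqrt (adjoint T ∘L T) x‖ = ‖T x‖ := by
  have h1 := re_inner_eq_norm_sqrt_sq (ContinuousLinearMap.isPositive_adjoint_comp_self T) x
  rw [ContinuousLinearMap.comp_apply, ContinuousLinearMap.adjoint_inner_right,
    inner_self_eq_ofReal] at h1
  have h2 : ‖T x‖ ^ 2 = ‖CFC.sqrt (adjoint T ∘L T) x‖ ^ 2 := Complex.ofReal_injective h1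
  exact ((sq_eq_sq₀ (norm_nonneg _) (norm_nonneg _)).1 h2).symm

/-- Polar decomposition: `T = W P` and `P = W* T` with `P = (T* T)^(1/2)` and a contraction
`W`. -/
theorem exists_polar (T : H →L[ℂ] K) : ∃ W : H →L[ℂ] K, (∀ x, ‖W x‖ ≤ ‖x‖) ∧
    (∀ x, W (CFC.sqrt (adjoint T ∘L T) x) = T x) ∧
    ∀ x, adjoint W (T x) = CFC.sqrt (adjoint T ∘L T) x := by
  obtain ⟨W, h1, h2⟩ := exists_contraction_comp_eq
    (R := (CFC.sqrt (adjoint T ∘L T)).toLinearMap) (T := T.toLinearMap)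
    fun e => (norm_sqrt_adjoint_comp_self T e).ge
  refine ⟨W, h1, h2, fun x => ?_⟩
  have hW : ∀ y, ‖adjoint W y‖ ≤ ‖y‖ := fun y => by
    have h3 := (adjoint W).le_of_opNorm_le (c := 1) (by
      rw [LinearIsometryEquiv.norm_map]
      exact W.opNorm_le_bound zero_le_one fun x => by simpa using h1 x) y
    simpa using h3
  set p := CFC.sqrt (adjoint T ∘L T) x with hp
  -- Expanding the square, the cross term is `⟪T x, W p⟫ = ‖T x‖²`, while `‖W* T x‖` is at most `‖T
  -- x‖` and `‖p‖ = ‖T x‖`.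
  have h4 : ‖adjoint W (T x) - p‖ ^ 2 ≤ 0 := by
    rw [@norm_sub_sq ℂ, ContinuousLinearMap.adjoint_inner_left]
    have h5 : W p = T x := h2 x
    rw [h5, inner_self_eq_norm_sq]
    have h6 : ‖p‖ = ‖T x‖ := norm_sqrt_adjoint_comp_self T x
    have h7 : ‖adjoint W (T x)‖ ^ 2 ≤ ‖T x‖ ^ 2 := by gcongr; exact hW _
    rw [h6]
    linarith
  have h8 : ‖adjoint W (T x) - p‖ = 0 := by
    rw [← pow_eq_zero_iff two_ne_zero]
    exact le_antisymm h4 (by positivity)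
  exact sub_eq_zero.1 (norm_eq_zero.1 h8)

end Factorization

/-! ### Complex conjugation in a fixed basis -/

section Conjugation

variable {H K : Type*} [NormedAddCommGroup H] [InnerProductSpace ℂ H] [CompleteSpace H]
  [NormedAddCommGroup K] [InnerProductSpace ℂ K] [CompleteSpace K]

/-- Complex conjugation with respect to the fixed Hilbert basis. -/
def cj (x : H) : H := (basis H).repr.symm (star ((basis H).repr x))

theorem cj_add (x y : H) : cj (x + y) = cj x + cj y := by
  simp [cj]

theorem cj_smul (c : ℂ) (x : H) : cj (c • x) = starRingEnd ℂ c • cj x := by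
  simp [cj]

theorem cj_cj (x : H) : cj (cj x) = x := by
  simp [cj]

theorem inner_cj_cj (x y : H) : inner ℂ (cj x) (cj y) = inner ℂ y x := by
  rw [cj, cj, LinearIsometryEquiv.inner_map_map, ← (basis H).repr.inner_map_map y x,
    lp.inner_eq_tsum, lp.inner_eq_tsum]
  refine tsum_congr fun i => ?_
  simp [mul_comm]

theorem norm_cj (x : H) : ‖cj x‖ = ‖x‖ := by
  rw [← sq_eq_sq₀ (norm_nonneg _) (norm_nonneg _), ← inner_self_eq_norm_sq (𝕜 := ℂ),
    ← inner_self_eq_norm_sq (𝕜 := ℂ), inner_cj_cj]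

theorem enorm_cj (x : H) : ‖cj x‖ₑ = ‖x‖ₑ := by
  rw [← ofReal_norm, norm_cj, ofReal_norm]

/-- The complex conjugate of an operator. -/
def cjOp (X : H →L[ℂ] K) : H →L[ℂ] K :=
  LinearMap.mkContinuous
    { toFun := fun x => cj (X (cj x))
      map_add' := fun x y => by simp [cj_add]
      map_smul' := fun c x => by simp [cj_smul] } ‖X‖ fun x => by
    refine (norm_cj _).trans_le ((X.le_opNorm _).trans_eq ?_)
    rw [norm_cj]

theorem cjOp_apply (X : H →L[ℂ] K) (x : H) : cjOp X x = cj (X (cj x)) := rfl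

theorem adjoint_cjOp (X : H →L[ℂ] K) : adjoint (cjOp X) = cjOp (adjoint X) := by
  refine ((ContinuousLinearMap.eq_adjoint_iff _ _).2 fun x y => ?_).symm
  rw [cjOp_apply, cjOp_apply]
  conv_lhs => rw [← cj_cj y, inner_cj_cj]
  conv_rhs => rw [← cj_cj x, inner_cj_cj]
  rw [ContinuousLinearMap.adjoint_inner_right]

end Conjugation

/-! ### Kraus operators relative to a fixed vector; the Lo–Popescu exchange -/

section Kraus

universe u v
variable {A A₁ : Type u} {B B₁ : Type v} [NormedAddCommGroup A] [InnerProductSpace ℂ A]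
  [CompleteSpace A] [NormedAddCommGroup B] [InnerProductSpace ℂ B] [CompleteSpace B]
  [NormedAddCommGroup A₁] [InnerProductSpace ℂ A₁] [CompleteSpace A₁]
  [NormedAddCommGroup B₁] [InnerProductSpace ℂ B₁] [CompleteSpace B₁]

/-- A vector of `A ⊗ B` as a linear map from `B` to `A`. -/
def toMapA (x : HTensor A B) : B →ₗ[ℂ] A where
  -- The slice is conjugate-linear in `b`; conjugating first makes the map linear.
  toFun b := sliceA A (cj b) x
  map_add' b b' := ext_inner_left ℂ fun a => by
    simp only [inner_add_right, inner_sliceA, cj_add, ← tensL_apply, map_add, inner_add_left]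
  map_smul' c b := ext_inner_left ℂ fun a => by
    simp [inner_smul_right, inner_sliceA, cj_smul, ← tensL_apply, inner_smul_left]

/-- A vector of `A ⊗ B` as a linear map from `A` to `B`. -/
def toMapB (x : HTensor A B) : A →L[ℂ] B :=
  LinearMap.mkContinuous
    { toFun := fun a => sliceB B (cj a) x
      map_add' := fun a a' => ext_inner_left ℂ fun b => by
        simp only [inner_add_right, inner_sliceB, cj_add, ← tensL_apply, map_add, add_apply,
          inner_add_left]
      map_smul' := fun c a => ext_inner_left ℂ fun b => by
        simp [inner_smul_right, inner_sliceB, cj_smul, ← tensL_apply, inner_smul_left] }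
    ‖x‖ fun a => by
      have h : ‖sliceB B (cj a)‖ ≤ ‖a‖ := by
        rw [sliceB, LinearIsometryEquiv.norm_map]
        refine ContinuousLinearMap.opNorm_le_bound _ (norm_nonneg _) fun b => ?_
        rw [tensL_apply, norm_tens, norm_cj]
      refine ((sliceB B (cj a)).le_opNorm x).trans ?_
      rw [mul_comm]
      gcongr

theorem toMapB_apply (x : HTensor A B) (a : A) : toMapB x a = sliceB B (cj a) x := rfl

/-- A family of vectors whose reduced states on Bob's side sum to that of `x` arises from `x` by
Kraus operators of Alice. -/
theorem exists_kraus_left {ι : Type*} {x : HTensor A B} {ψ : ι → HTensor A₁ B}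
    (h : ∀ b : B, ∑' i, ‖sliceA A₁ b (ψ i)‖ₑ ^ 2 = ‖sliceA A b x‖ₑ ^ 2) :
    ∃ K : ι → A →L[ℂ] A₁, (∀ a, ∑' i, ‖K i a‖ₑ ^ 2 ≤ ‖a‖ₑ ^ 2) ∧
      ∀ i, opTensor (K i) (ContinuousLinearMap.id ℂ B) x = ψ i := by
  -- For the associated maps `B → A`, equality of Bob's reduced states reads `∑ Tᵢ* Tᵢ = R* R`,
  -- which is the hypothesis of Douglas' lemma.
  obtain ⟨K, h1, h2⟩ := exists_family_comp_eq (R := toMapA x) (T := fun i => toMapA (ψ i))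
    fun b => (h (cj b)).le
  refine ⟨K, h1, fun i => ext_sliceA fun b => ?_⟩
  have h3 := h2 i (cj b)
  simp only [toMapA, LinearMap.coe_mk, AddHom.coe_mk, cj_cj] at h3
  have h4 : adjoint (ContinuousLinearMap.id ℂ B) = ContinuousLinearMap.id ℂ B :=
    ContinuousLinearMap.adjoint_one
  rw [sliceA_opTensor, h4, ContinuousLinearMap.id_apply, h3]

theorem exists_kraus_right {ι : Type*} {x : HTensor A B} {ψ : ι → HTensor A B₁}
    (h : ∀ a : A, ∑' i, ‖sliceB B₁ a (ψ i)‖ₑ ^ 2 = ‖sliceB B a x‖ₑ ^ 2) :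
    ∃ R : ι → B →L[ℂ] B₁, (∀ b, ∑' i, ‖R i b‖ₑ ^ 2 ≤ ‖b‖ₑ ^ 2) ∧
      ∀ i, opTensor (ContinuousLinearMap.id ℂ A) (R i) x = ψ i := by
  obtain ⟨R, h1, h2⟩ := exists_family_comp_eq (R := (toMapB x).toLinearMap)
    (T := fun i => (toMapB (ψ i)).toLinearMap) fun a => (h (cj a)).le
  refine ⟨R, h1, fun i => ext_sliceB fun a => ?_⟩
  have h3 : R i (toMapB x (cj a)) = toMapB (ψ i) (cj a) := h2 i (cj a)
  simp only [toMapB_apply, cj_cj] at h3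
  have h4 : adjoint (ContinuousLinearMap.id ℂ A) = ContinuousLinearMap.id ℂ A :=
    ContinuousLinearMap.adjoint_one
  rw [sliceB_opTensor, h4, ContinuousLinearMap.id_apply, h3]

theorem norm_adjoint_apply_le {H K : Type*} [NormedAddCommGroup H] [InnerProductSpace ℂ H]
    [CompleteSpace H] [NormedAddCommGroup K] [InnerProductSpace ℂ K] [CompleteSpace K]
    {W : H →L[ℂ] K} (h : ∀ x, ‖W x‖ ≤ ‖x‖) (y : K) : ‖adjoint W y‖ ≤ ‖y‖ := by
  have h3 := (adjoint W).le_of_opNorm_le (c := 1) (by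
    rw [LinearIsometryEquiv.norm_map]
    exact W.opNorm_le_bound zero_le_one fun x => by simpa using h x) y
  simpa using h3

theorem adjoint_sqrt {H : Type*} [NormedAddCommGroup H] [InnerProductSpace ℂ H]
    [CompleteSpace H] (T : H →L[ℂ] H) : adjoint (CFC.sqrt T) = CFC.sqrt T :=
  ((ContinuousLinearMap.eq_adjoint_iff _ _).2 fun x y => sqrt_inner_comm T x y).symm

/-- Bob's Kraus operator `R`, applied to the vector given by `T`, can be simulated by an operator
of Alice followed by a contraction of Bob. -/
theorem exists_transpose {H K L : Type*} [NormedAddCommGroup H] [InnerProductSpace ℂ H]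
    [CompleteSpace H] [NormedAddCommGroup K] [InnerProductSpace ℂ K] [CompleteSpace K]
    [NormedAddCommGroup L] [InnerProductSpace ℂ L] [CompleteSpace L]
    {T W : H →L[ℂ] K} {P : H →L[ℂ] H} (hP : adjoint P = P) (hW : ∀ x, ‖W x‖ ≤ ‖x‖)
    (h1 : ∀ x, W (P x) = T x) (h2 : ∀ x, adjoint W (T x) = P x) (R : K →L[ℂ] L) :
    ∃ (n : H →L[ℂ] H) (V : K →L[ℂ] L), (∀ x, ‖V x‖ ≤ ‖x‖) ∧ (∀ x, V (T (n x)) = R (T x)) ∧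
      ∀ x, ‖adjoint n x‖ ≤ ‖R (W x)‖ := by
  obtain ⟨w, hw, hw1, -⟩ := exists_polar (R ∘L W)
  have hs : ∀ x, ‖CFC.sqrt (adjoint (R ∘L W) ∘L (R ∘L W)) x‖ = ‖R (W x)‖ :=
    norm_sqrt_adjoint_comp_self (R ∘L W)
  have hsa := adjoint_sqrt (adjoint (R ∘L W) ∘L (R ∘L W))
  set s := CFC.sqrt (adjoint (R ∘L W) ∘L (R ∘L W))
  obtain ⟨u, hu, hu1, hu2⟩ := exists_polar (s ∘L P)
  have hza := adjoint_sqrt (adjoint (s ∘L P) ∘L (s ∘L P))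
  set z := CFC.sqrt (adjoint (s ∘L P) ∘L (s ∘L P))
  -- Here `R W = w s` and `s P = u z` are polar decompositions. Since `z` and `P` are self-adjoint,
  -- `u* s P = z` also gives `P s u = z`. With `n = s u` and `V = w u W*` this yields `V T n = w u P
  -- s u = w u z = w s P = R T`.
  refine ⟨s ∘L u, w ∘L u ∘L adjoint W, fun x => ?_, fun x => ?_, fun x => ?_⟩
  · exact (hw _).trans ((hu _).trans (norm_adjoint_apply_le hW x))
  · have h3 : adjoint u ∘L (s ∘L P) = z := ContinuousLinearMap.ext hu2
    have h4 : P (s (u x)) = z x := by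
      rw [← hza, ← h3]
      simp [ContinuousLinearMap.adjoint_comp, hsa, hP]
    simp only [ContinuousLinearMap.comp_apply, h2, h4, hu1, hw1, h1]
  · rw [ContinuousLinearMap.adjoint_comp, hsa, ContinuousLinearMap.comp_apply, ← hs]
    exact norm_adjoint_apply_le hu _

/-- A measurement by Bob on a pure state can be simulated by a measurement by Alice followed by
contractions of Bob. -/
theorem exists_simulation {ι : Type*} {x : HTensor A B} {ψ : ι → HTensor A B₁}
    (h : ∀ a : A, ∑' i, ‖sliceB B₁ a (ψ i)‖ₑ ^ 2 = ‖sliceB B a x‖ₑ ^ 2) :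
    ∃ (N : ι → A →L[ℂ] A) (V : ι → B →L[ℂ] B₁), (∀ a, ∑' i, ‖N i a‖ₑ ^ 2 ≤ ‖a‖ₑ ^ 2) ∧
      (∀ i b, ‖V i b‖ ≤ ‖b‖) ∧ ∀ i, opTensor (N i) (V i) x = ψ i := by
  obtain ⟨R, hR, hψ⟩ := exists_kraus_right h
  obtain ⟨W, hW, h1, h2⟩ := exists_polar (toMapB x)
  choose n V hV hn hn' using fun i =>
    exists_transpose (adjoint_sqrt (adjoint (toMapB x) ∘L toMapB x)) hW h1 h2 (R i)
  -- Precomposing the map `A → B` of a vector with `n` amounts to applying the transpose of `n` to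
  -- Alice's factor, and the transpose is the conjugate of the adjoint.
  refine ⟨fun i => cjOp (adjoint (n i)), V, fun a => ?_, hV, fun i => ?_⟩
  · calc ∑' i, ‖cjOp (adjoint (n i)) a‖ₑ ^ 2 ≤ ∑' i, ‖R i (W (cj a))‖ₑ ^ 2 := by
          refine ENNReal.tsum_le_tsum fun i => ?_
          rw [cjOp_apply, enorm_cj]
          gcongr
          exact enorm_le_iff_norm_le.2 (hn' i _)
      _ ≤ ‖W (cj a)‖ₑ ^ 2 := hR _
      _ ≤ ‖a‖ₑ ^ 2 := by
          gcongr
          rw [← enorm_cj a]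
          exact enorm_le_iff_norm_le.2 (hW _)
  · change opTensor (cjOp (adjoint (n i))) (V i) x = ψ i
    rw [← hψ]
    refine ext_sliceB fun a => ?_
    have h4 : adjoint (ContinuousLinearMap.id ℂ A) = ContinuousLinearMap.id ℂ A :=
      ContinuousLinearMap.adjoint_one
    rw [sliceB_opTensor, sliceB_opTensor, h4, ContinuousLinearMap.id_apply, ← adjoint_cjOp,
      ContinuousLinearMap.adjoint_adjoint, cjOp_apply, ← toMapB_apply, hn, toMapB_apply, cj_cj]

end Kraus

/-! ### Completing a subnormalized family to an instrument -/

section Complement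

variable {H K : Type*} [NormedAddCommGroup H] [InnerProductSpace ℂ H] [CompleteSpace H]
  [NormedAddCommGroup K] [InnerProductSpace ℂ K] [CompleteSpace K]

theorem tsum_enorm_sum {ι κ : Type*} (f : ι ⊕ κ → ℝ≥0∞) :
    ∑' i, f i = ∑' i, f (.inl i) + ∑' k, f (.inr k) :=
  Summable.tsum_sum ENNReal.summable ENNReal.summable

/-- Given Kraus operators `L i` and a complement `S` with `∑ Lᵢ* Lᵢ + S* S = 1`, the family
consisting of the maps `Lᵢ · Lᵢ*` and of the maps `F k (S · S*)`. -/
def complete {ι κ : Type*} (L : ι → H →L[ℂ] K) (S : H →L[ℂ] H) (F : κ → Op H K) :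
    ι ⊕ κ → Op H K :=
  -- After the defect `S` the system is still `H`; an available instrument `F` carries it to the
  -- common output space `K` without losing trace.
  Sum.elim (fun i => conjOp (L i)) fun k => F k ∘ₗ conjOp S

theorem complete_inl {ι κ : Type*} (L : ι → H →L[ℂ] K) (S : H →L[ℂ] H) (F : κ → Op H K) (i : ι) :
    complete L S F (.inl i) = conjOp (L i) := rfl

theorem complete_inr {ι κ : Type*} (L : ι → H →L[ℂ] K) (S : H →L[ℂ] H) (F : κ → Op H K) (k : κ) :
    complete L S F (.inr k) = F k ∘ₗ conjOp S := rfl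

theorem complete_isInstrument {ι κ : Type*} {L : ι → H →L[ℂ] K} {S : H →L[ℂ] H}
    {F : κ → Op H K} (hF : IsInstrument F)
    (h : ∀ x, ∑' i, ‖L i x‖ₑ ^ 2 + ‖S x‖ₑ ^ 2 = ‖x‖ₑ ^ 2) :
    IsInstrument (complete L S F) := by
  refine isInstrument_of_ptr ?_ fun ρ hρ => ?_
  · rintro (i | k)
    · exact conjOp_isCP _
    · exact (hF.1 k).comp (conjOp_isCP _)
  · have hd := isDecomp_sqrt hρ
    rw [tsum_enorm_sum]
    simp only [complete, Sum.elim_inl, Sum.elim_inr, LinearMap.comp_apply]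
    rw [hF.tsum_ptr _ ((conjOp_isCP S).isPositive ρ hρ)]
    simp only [ptr_conjOp _ hd]
    rw [hd.ptr_eq, ENNReal.tsum_comm, ← ENNReal.tsum_add]
    exact tsum_congr fun j => h _

theorem IsInstrument.comp_equiv {ι κ : Type*} {F : κ → Op H K} (hF : IsInstrument F)
    (e : ι ≃ κ) : IsInstrument fun i => F (e i) :=
  ⟨fun i => hF.1 (e i), fun ρ => e.hasSum_iff.2 (hF.2 ρ)⟩

end Complement

/-! ### Completed instruments are local -/

section Local

universe u v
variable {A A₁ : Type u} {B B₁ : Type v} [NormedAddCommGroup A] [InnerProductSpace ℂ A]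
  [CompleteSpace A] [NormedAddCommGroup B] [InnerProductSpace ℂ B] [CompleteSpace B]
  [NormedAddCommGroup A₁] [InnerProductSpace ℂ A₁] [CompleteSpace A₁]
  [NormedAddCommGroup B₁] [InnerProductSpace ℂ B₁] [CompleteSpace B₁]

/-- An operator of Alice acts on each slice along a basis of `B` separately, so the identity on `A`
is summed over slices. -/
theorem tsum_opTensor_left_compl {ι : Type*} {L : ι → A →L[ℂ] A₁} {S : A →L[ℂ] A}
    (h : ∀ x, ∑' i, ‖L i x‖ₑ ^ 2 + ‖S x‖ₑ ^ 2 = ‖x‖ₑ ^ 2) (x : HTensor A B) :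
    ∑' i, ‖opTensor (L i) (ContinuousLinearMap.id ℂ B) x‖ₑ ^ 2 +
      ‖opTensor S (ContinuousLinearMap.id ℂ B) x‖ₑ ^ 2 = ‖x‖ₑ ^ 2 := by
  have h1 : adjoint (ContinuousLinearMap.id ℂ B) = ContinuousLinearMap.id ℂ B :=
    ContinuousLinearMap.adjoint_one
  simp only [← tsum_sliceA (opTensor _ _ x), sliceA_opTensor, h1]
  rw [ENNReal.tsum_comm, ← tsum_sliceA x, ← ENNReal.tsum_add]
  exact tsum_congr fun j => h _

theorem tsum_opTensor_right_compl {ι : Type*} {L : ι → B →L[ℂ] B₁} {S : B →L[ℂ] B}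
    (h : ∀ x, ∑' i, ‖L i x‖ₑ ^ 2 + ‖S x‖ₑ ^ 2 = ‖x‖ₑ ^ 2) (x : HTensor A B) :
    ∑' i, ‖opTensor (ContinuousLinearMap.id ℂ A) (L i) x‖ₑ ^ 2 +
      ‖opTensor (ContinuousLinearMap.id ℂ A) S x‖ₑ ^ 2 = ‖x‖ₑ ^ 2 := by
  have h1 : adjoint (ContinuousLinearMap.id ℂ A) = ContinuousLinearMap.id ℂ A :=
    ContinuousLinearMap.adjoint_one
  simp only [← tsum_sliceB (opTensor _ _ x), sliceB_opTensor, h1]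
  rw [ENNReal.tsum_comm, ← tsum_sliceB x, ← ENNReal.tsum_add]
  exact tsum_congr fun j => h _

theorem isTensorOp_conjOp (X : A →L[ℂ] A₁) (Y : B →L[ℂ] B₁) :
    IsTensorOp (conjOp (opTensor X Y)) (conjOp X) (conjOp Y) :=
  ⟨conjOp_isCP _, fun a b => by
    rw [conjOp_ketbra, conjOp_ketbra, conjOp_ketbra, opTensor_tens, opTensor_ketbra]⟩

theorem isTensorOp_left (X : A →L[ℂ] A₁) :
    IsTensorOp (conjOp (opTensor X (ContinuousLinearMap.id ℂ B))) (conjOp X) LinearMap.id := by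
  have h := isTensorOp_conjOp X (ContinuousLinearMap.id ℂ B)
  rwa [conjOp_id] at h

theorem isTensorOp_right (Y : B →L[ℂ] B₁) :
    IsTensorOp (conjOp (opTensor (ContinuousLinearMap.id ℂ A) Y)) LinearMap.id (conjOp Y) := by
  have h := isTensorOp_conjOp (ContinuousLinearMap.id ℂ A) Y
  rwa [conjOp_id] at h

theorem complete_isTensorOp_left {ι : Type*} {L : ι → A →L[ℂ] A₁} {S : A →L[ℂ] A}
    {F : ℕ → Op (HTensor A B) (HTensor A₁ B)} {J : ℕ → Op A A₁}
    (h : ∀ k, IsTensorOp (F k) (J k) LinearMap.id) (n : ι ⊕ ℕ) :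
    IsTensorOp (complete (fun i => opTensor (L i) (ContinuousLinearMap.id ℂ B))
      (opTensor S (ContinuousLinearMap.id ℂ B)) F n) (complete L S J n) LinearMap.id := by
  cases n with
  | inl i =>
    rw [complete_inl, complete_inl]
    exact isTensorOp_left (L i)
  | inr k =>
    rw [complete_inr, complete_inr]
    refine ⟨(h k).1.comp (conjOp_isCP _), fun a b => ?_⟩
    rw [LinearMap.comp_apply, LinearMap.comp_apply, conjOp_ketbra, conjOp_ketbra, opTensor_tens]
    exact (h k).2 (S a) b

theorem complete_isTensorOp_right {ι : Type*} {L : ι → B →L[ℂ] B₁} {S : B →L[ℂ] B}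
    {F : ℕ → Op (HTensor A B) (HTensor A B₁)} {J : ℕ → Op B B₁}
    (h : ∀ k, IsTensorOp (F k) LinearMap.id (J k)) (n : ι ⊕ ℕ) :
    IsTensorOp (complete (fun i => opTensor (ContinuousLinearMap.id ℂ A) (L i))
      (opTensor (ContinuousLinearMap.id ℂ A) S) F n) LinearMap.id (complete L S J n) := by
  cases n with
  | inl i =>
    rw [complete_inl, complete_inl]
    exact isTensorOp_right (L i)
  | inr k =>
    rw [complete_inr, complete_inr]
    refine ⟨(h k).1.comp (conjOp_isCP _), fun a b => ?_⟩
    rw [LinearMap.comp_apply, LinearMap.comp_apply, conjOp_ketbra, conjOp_ketbra, opTensor_tens]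
    exact (h k).2 a (S b)

theorem complete_isLocalAlice {ι : Type*} {L : ι → A →L[ℂ] A₁} {S : A →L[ℂ] A}
    {F : ℕ → Op (HTensor A B) (HTensor A₁ B)} (hF : IsLocalAlice F)
    (h : ∀ x, ∑' i, ‖L i x‖ₑ ^ 2 + ‖S x‖ₑ ^ 2 = ‖x‖ₑ ^ 2) (e : ℕ ≃ ι ⊕ ℕ) :
    IsLocalAlice fun n => complete (fun i => opTensor (L i) (ContinuousLinearMap.id ℂ B))
      (opTensor S (ContinuousLinearMap.id ℂ B)) F (e n) := by
  obtain ⟨h1, J, h2, h3⟩ := hF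
  refine ⟨(complete_isInstrument h1 (tsum_opTensor_left_compl h)).comp_equiv e,
    fun n => complete L S J (e n), (complete_isInstrument h2 h).comp_equiv e, fun n => complete_isTensorOp_left h3 (e n)⟩

theorem complete_isLocalBob {ι : Type*} {L : ι → B →L[ℂ] B₁} {S : B →L[ℂ] B}
    {F : ℕ → Op (HTensor A B) (HTensor A B₁)} (hF : IsLocalBob F)
    (h : ∀ x, ∑' i, ‖L i x‖ₑ ^ 2 + ‖S x‖ₑ ^ 2 = ‖x‖ₑ ^ 2) (e : ℕ ≃ ι ⊕ ℕ) :
    IsLocalBob fun n => complete (fun i => opTensor (ContinuousLinearMap.id ℂ A) (L i))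
      (opTensor (ContinuousLinearMap.id ℂ A) S) F (e n) := by
  obtain ⟨h1, J, h2, h3⟩ := hF
  refine ⟨(complete_isInstrument h1 (tsum_opTensor_right_compl h)).comp_equiv e,
    fun n => complete L S J (e n), (complete_isInstrument h2 h).comp_equiv e, fun n => complete_isTensorOp_right h3 (e n)⟩

/-- The instrument that does nothing, with the only outcome `0`. -/
def trivialInstrument (H : Type*) [NormedAddCommGroup H] [InnerProductSpace ℂ H]
    [CompleteSpace H] (k : ℕ) : Op H H :=
  if k = 0 then LinearMap.id else 0

theorem trivialInstrument_isInstrument (H : Type*) [NormedAddCommGroup H] [InnerProductSpace ℂ H]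
    [CompleteSpace H] : IsInstrument (trivialInstrument H) := by
  constructor
  · intro k
    unfold trivialInstrument
    split_ifs
    · exact fun n ρ h => h
    · exact isCP_zero
  · intro ρ
    convert! hasSum_ite_eq (0 : ℕ) (trace ρ) using 2 with k
    unfold trivialInstrument
    split_ifs
    · rfl
    · exact (traceL H).map_zero

theorem trivialInstrument_isLocalAlice : IsLocalAlice (trivialInstrument (HTensor A B)) := by
  refine ⟨trivialInstrument_isInstrument _, _, trivialInstrument_isInstrument A, fun k =>
    ⟨(trivialInstrument_isInstrument _).1 k, fun a b => ?_⟩⟩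
  unfold trivialInstrument
  split_ifs
  · exact (opTensor_ketbra a b).symm
  · exact (opTensor_zero_left _).symm

end Local

/-! ### Adding rounds to a protocol -/

section Rounds

universe u v w
variable {Ω : Type w} {A A₁ A' : Type u} {B B₁ B' : Type v}
  [NormedAddCommGroup A] [InnerProductSpace ℂ A] [CompleteSpace A]
  [NormedAddCommGroup B] [InnerProductSpace ℂ B] [CompleteSpace B]
  [NormedAddCommGroup A₁] [InnerProductSpace ℂ A₁] [CompleteSpace A₁]
  [NormedAddCommGroup B₁] [InnerProductSpace ℂ B₁] [CompleteSpace B₁]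
  [NormedAddCommGroup A'] [InnerProductSpace ℂ A'] [CompleteSpace A']
  [NormedAddCommGroup B'] [InnerProductSpace ℂ B'] [CompleteSpace B']

theorem isBoundedPos_of_hasSum {H K L : Type*} [NormedAddCommGroup H] [InnerProductSpace ℂ H]
    [CompleteSpace H] [NormedAddCommGroup K] [InnerProductSpace ℂ K] [CompleteSpace K]
    [NormedAddCommGroup L] [InnerProductSpace ℂ L] [CompleteSpace L] {ι : Type*}
    {F : ι → Op H K} (hF : IsInstrument F) {P : ι → Op K L} (hP : ∀ k, IsBoundedPos (P k) 1)
    {E : Op H L} (hE : ∀ ρ, HasSum (fun k => (P k (F k ρ)).1) (E ρ).1) : IsBoundedPos E 1 := by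
  intro ρ hρ
  have h1 := fun k => hP k _ ((hF.1 k).isPositive ρ hρ)
  refine ⟨isPositive_of_hasSum (hE ρ) fun k => (h1 k).1, ?_⟩
  rw [ptr_hasSum (hE ρ) fun k => (h1 k).1, ENNReal.coe_one, one_mul, ← hF.tsum_ptr ρ hρ]
  exact ENNReal.tsum_le_tsum fun k => by simpa using (h1 k).2

/-- The branches `P k` of a protocol are not postulated to be instruments, so positivity and the
trace bound are derived from the structure of the rounds. -/
theorem IsLOCCRounds.isBoundedPos {n : ℕ} {I : Ω → Op (HTensor A B) (HTensor A' B')}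
    (h : IsLOCCRounds A' B' n A B I) (ω : Ω) : IsBoundedPos (I ω) 1 := by
  induction n generalizing A B with
  | zero =>
    obtain ⟨ω₀, E, G, -, -, h1, -, h2⟩ := h
    by_cases hω : ω = ω₀
    · exact hω ▸ h1.isBoundedPos
    · intro ρ _
      rw [h2 ω hω]
      refine ⟨ContinuousLinearMap.isPositive_zero, ?_⟩
      have h3 : ptr ((0 : Op (HTensor A B) (HTensor A' B')) ρ).1 = 0 := by simp [ptr, qf]
      rw [h3]
      exact zero_le
  | succ n ih =>
    rcases h with ⟨A₁, _, _, _, F, P, hF, hP, h⟩ | ⟨B₁, _, _, _, F, P, hF, hP, h⟩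
    · exact isBoundedPos_of_hasSum hF.1 (fun k => ih (hP k)) (h ω)
    · exact isBoundedPos_of_hasSum hF.1 (fun k => ih (hP k)) (h ω)

/-- Padding by a do-nothing round; branches of one protocol must share their number of rounds. -/
theorem IsLOCCRounds.succ {n : ℕ} {I : Ω → Op (HTensor A B) (HTensor A' B')}
    (h : IsLOCCRounds A' B' n A B I) : IsLOCCRounds A' B' (n + 1) A B I := by
  refine Or.inl ⟨A, _, _, _, trivialInstrument _, fun _ => I, trivialInstrument_isLocalAlice,
    fun _ => h, fun ω ρ => ?_⟩
  convert! hasSum_ite_eq (0 : ℕ) (I ω ρ).1 using 2 with k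
  unfold trivialInstrument
  split_ifs
  · rfl
  · simp

theorem hasSum_of_complete {H K L : Type*} [NormedAddCommGroup H] [InnerProductSpace ℂ H]
    [CompleteSpace H] [NormedAddCommGroup K] [InnerProductSpace ℂ K] [CompleteSpace K]
    [NormedAddCommGroup L] [InnerProductSpace ℂ L] [CompleteSpace L] {ι κ : Type*}
    {X : ι → H →L[ℂ] K} {S : H →L[ℂ] H} {F : κ → Op H K} {e : ℕ ≃ ι ⊕ κ} {P : ι ⊕ κ → Op K L}
    {x : H} {T : L →L[ℂ] L} (h : ∑' i, ‖X i x‖ₑ ^ 2 + ‖S x‖ₑ ^ 2 = ‖x‖ₑ ^ 2)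
    (hx : ∑' i, ‖X i x‖ₑ ^ 2 = ‖x‖ₑ ^ 2)
    (hT : HasSum (fun n => (P (e n) (complete X S F (e n) (ketbra x))).1) T) :
    HasSum (fun i => (P (.inl i) (ketbra (X i x))).1) T := by
  have hT := (e.hasSum_iff (f := fun n => (P n (complete X S F n (ketbra x))).1)).1 hT
  rw [← Function.Injective.hasSum_iff Sum.inl_injective] at hT
  · simpa [Function.comp_def, complete, conjOp_ketbra] using hT
  · rintro (i | k) hk
    · exact absurd ⟨i, rfl⟩ hk
    · rw [hx] at h
      -- The family `X` already exhausts the norm of `x`, so the added outcomes do not occur on `x`.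
      have h1 : S x = 0 := by
        simpa using (ENNReal.add_right_inj (enorm_sq_ne_top x)).1 (h.trans (add_zero _).symm)
      have h2 : ketbra (0 : H) = 0 := Subtype.ext (by simp [ketbra])
      simp [complete, conjOp_ketbra, h1, h2]

/-- A measurement by Alice with Kraus operators `L i` followed by quantum operations `D i` with
LOCC. -/
theorem exists_prepend_alice {ι : Type*} [Countable ι] [Nonempty ι] {m : ℕ} {L : ι → A →L[ℂ] A₁}
    (hL : ∀ a, ∑' i, ‖L i a‖ₑ ^ 2 ≤ ‖a‖ₑ ^ 2)
    {F : ℕ → Op (HTensor A B) (HTensor A₁ B)} (hF : IsLocalAlice F)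
    {D : ι → Op (HTensor A₁ B) (HTensor A' B')} (hD : ∀ i, IsTPCP (D i))
    (hD' : ∀ i, IsLOCCRounds A' B' m A₁ B fun _ : Unit => D i) :
    ∃ C : Op (HTensor A B) (HTensor A' B'), IsTPCP C ∧
      IsLOCCRounds A' B' (m + 1) A B (fun _ : Unit => C) ∧
      ∀ x, ∑' i, ‖opTensor (L i) (ContinuousLinearMap.id ℂ B) x‖ₑ ^ 2 = ‖x‖ₑ ^ 2 →
        HasSum (fun i => (D i (ketbra (opTensor (L i) (ContinuousLinearMap.id ℂ B) x))).1)
          (C (ketbra x)).1 := by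
  obtain ⟨-, S, -, hS⟩ := exists_sqrt_sum hL
  let e : ℕ ≃ ι ⊕ ℕ := Classical.choice nonempty_equiv_of_countable
  let P : ι ⊕ ℕ → Op (HTensor A₁ B) (HTensor A' B') :=
    Sum.elim D fun _ => D (Classical.arbitrary ι)
  have hF' := complete_isLocalAlice hF hS e
  have hP : ∀ n, IsTPCP (P n) := by rintro (i | k) <;> exact hD _
  have hP' : ∀ n, IsLOCCRounds A' B' m A₁ B fun _ : Unit => P n := by
    rintro (i | k) <;> exact hD' _
  obtain ⟨C, hC, hC'⟩ := exists_sum_comp hF'.1 fun n => hP (e n)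
  refine ⟨C, hC, Or.inl ⟨A₁, _, _, _, _, fun n _ => P (e n), hF', fun n => hP' _, fun _ => hC'⟩,
    fun x hx => ?_⟩
  exact hasSum_of_complete (P := P) (tsum_opTensor_left_compl hS x) hx (hC' _)

/-- A measurement by Bob with Kraus operators `L i` followed by quantum operations `D i` with
LOCC. -/
theorem exists_prepend_bob {ι : Type*} [Countable ι] [Nonempty ι] {m : ℕ} {L : ι → B →L[ℂ] B₁}
    (hL : ∀ a, ∑' i, ‖L i a‖ₑ ^ 2 ≤ ‖a‖ₑ ^ 2)
    {F : ℕ → Op (HTensor A B) (HTensor A B₁)} (hF : IsLocalBob F)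
    {D : ι → Op (HTensor A B₁) (HTensor A' B')} (hD : ∀ i, IsTPCP (D i))
    (hD' : ∀ i, IsLOCCRounds A' B' m A B₁ fun _ : Unit => D i) :
    ∃ C : Op (HTensor A B) (HTensor A' B'), IsTPCP C ∧
      IsLOCCRounds A' B' (m + 1) A B (fun _ : Unit => C) ∧
      ∀ x, ∑' i, ‖opTensor (ContinuousLinearMap.id ℂ A) (L i) x‖ₑ ^ 2 = ‖x‖ₑ ^ 2 →
        HasSum (fun i => (D i (ketbra (opTensor (ContinuousLinearMap.id ℂ A) (L i) x))).1)
          (C (ketbra x)).1 := by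
  obtain ⟨-, S, -, hS⟩ := exists_sqrt_sum hL
  let e : ℕ ≃ ι ⊕ ℕ := Classical.choice nonempty_equiv_of_countable
  let P : ι ⊕ ℕ → Op (HTensor A B₁) (HTensor A' B') :=
    Sum.elim D fun _ => D (Classical.arbitrary ι)
  have hF' := complete_isLocalBob hF hS e
  have hP : ∀ n, IsTPCP (P n) := by rintro (i | k) <;> exact hD _
  have hP' : ∀ n, IsLOCCRounds A' B' m A B₁ fun _ : Unit => P n := by
    rintro (i | k) <;> exact hD' _
  obtain ⟨C, hC, hC'⟩ := exists_sum_comp hF'.1 fun n => hP (e n)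
  refine ⟨C, hC, Or.inr ⟨B₁, _, _, _, _, fun n _ => P (e n), hF', fun n => hP' _, fun _ => hC'⟩,
    fun x hx => ?_⟩
  exact hasSum_of_complete (P := P) (tsum_opTensor_right_compl hS x) hx (hC' _)

end Rounds

/-! ### Refining a round into rank one pieces -/

section Decomposition

variable {H K L : Type*} [NormedAddCommGroup H] [InnerProductSpace ℂ H] [CompleteSpace H]
  [NormedAddCommGroup K] [InnerProductSpace ℂ K] [CompleteSpace K]
  [NormedAddCommGroup L] [InnerProductSpace ℂ L] [CompleteSpace L]

theorem IsInstrument.tsum_decomp {ι κ : Type*} {F : κ → Op H K} (hF : IsInstrument F) {x : H}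
    {ψ : κ → ι → K} (hψ : ∀ k, IsDecomp (F k (ketbra x)).1 (ψ k)) :
    ∑' i : κ × ι, ‖ψ i.1 i.2‖ₑ ^ 2 = ‖x‖ₑ ^ 2 := by
  rw [ENNReal.tsum_prod', ← ptr_ketbra, ← hF.tsum_ptr _ (ketbra_isPositive x)]
  exact tsum_congr fun k => ((hψ k).ptr_eq).symm

/-- The traces of the refined terms sum to at most `‖x‖²`, so the double series converges in norm;
its inner sums are identified by `IsBoundedPos.hasSum_ketbra`. -/
theorem hasSum_decomp {ι κ : Type*} {F : κ → Op H K} (hF : IsInstrument F) {P : κ → Op K L}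
    (hP : ∀ k, IsBoundedPos (P k) 1) {x : H} {ψ : κ → ι → K}
    (hψ : ∀ k, IsDecomp (F k (ketbra x)).1 (ψ k)) {T : L →L[ℂ] L}
    (hT : HasSum (fun k => (P k (F k (ketbra x))).1) T) :
    HasSum (fun i : κ × ι => (P i.1 (ketbra (ψ i.1 i.2))).1) T := by
  have h1 := fun i : κ × ι => hP i.1 _ (ketbra_isPositive (ψ i.1 i.2))
  have h2 : Summable fun i : κ × ι => (P i.1 (ketbra (ψ i.1 i.2))).1 := by
    refine summable_of_tsum_ptr (fun i => (h1 i).1) ?_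
    refine ne_top_of_le_ne_top (enorm_sq_ne_top x) ?_
    rw [← hF.tsum_decomp hψ]
    exact ENNReal.tsum_le_tsum fun i => by simpa [ptr_ketbra] using (h1 i).2
  have h3 := h2.hasSum.prod_fiberwise fun k =>
    (hP k).hasSum_ketbra ((hF.1 k).isPositive _ (ketbra_isPositive x)) (hψ k)
  rw [hT.unique h3]
  exact h2.hasSum

theorem eq_of_tsum_le {ι : Type*} {f g : ι → ℝ≥0∞} (h : ∀ i, f i ≤ g i)
    (hs : ∑' i, g i ≤ ∑' i, f i) (hf : ∑' i, f i ≠ ∞) (i : ι) : f i = g i := by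
  by_contra hne
  exact absurd (ENNReal.tsum_lt_tsum hf h (lt_of_le_of_ne (h i) hne)) hs.not_gt

end Decomposition

/-! ### Simulating a protocol on a given vector -/

section Simulation

universe u v w
variable {Ω : Type w} {A A₁ A' : Type u} {B B₁ B' : Type v}
  [NormedAddCommGroup A] [InnerProductSpace ℂ A] [CompleteSpace A]
  [NormedAddCommGroup B] [InnerProductSpace ℂ B] [CompleteSpace B]
  [NormedAddCommGroup A₁] [InnerProductSpace ℂ A₁] [CompleteSpace A₁]
  [NormedAddCommGroup B₁] [InnerProductSpace ℂ B₁] [CompleteSpace B₁]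
  [NormedAddCommGroup A'] [InnerProductSpace ℂ A'] [CompleteSpace A']
  [NormedAddCommGroup B'] [InnerProductSpace ℂ B'] [CompleteSpace B']

/-- Operators `X ω` of Alice and quantum operations `C ω` with `m` rounds of LOCC simulate `I` on
the state vector `x`. -/
def Simulates (m : ℕ) (I : Ω → Op (HTensor A B) (HTensor A' B')) (x : HTensor A B)
    (X : Ω → A →L[ℂ] A) (C : Ω → Op (HTensor A B) (HTensor A' B')) : Prop :=
  -- Douglas' lemma gives only an inequality on `A`; equality is demanded on `x` alone, and this
  -- makes completing outcomes have probability zero.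
  (∀ a, ∑' ω, ‖X ω a‖ₑ ^ 2 ≤ ‖a‖ₑ ^ 2) ∧
    ∑' ω, ‖opTensor (X ω) (ContinuousLinearMap.id ℂ B) x‖ₑ ^ 2 = ‖x‖ₑ ^ 2 ∧
    ∀ ω, IsTPCP (C ω) ∧ IsLOCCRounds A' B' m A B (fun _ : Unit => C ω) ∧
      I ω (ketbra x) = C ω (ketbra (opTensor (X ω) (ContinuousLinearMap.id ℂ B) x))

theorem comp_id_right {H K : Type*} [NormedAddCommGroup H] [InnerProductSpace ℂ H]
    [NormedAddCommGroup K] [InnerProductSpace ℂ K] (V : H →L[ℂ] K) :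
    V ∘L ContinuousLinearMap.id ℂ H = V := V.comp_id

/-- Measurements by Alice can be combined: first with Kraus operators `K i`, then with operators
`Y i ω`. -/
theorem exists_simulates_of_kraus {ι : Type*} [Countable ι] [Nonempty ι] {m : ℕ}
    {I : Ω → Op (HTensor A B) (HTensor A' B')} {x : HTensor A B} {K : ι → A →L[ℂ] A₁}
    (hK : ∀ a, ∑' i, ‖K i a‖ₑ ^ 2 ≤ ‖a‖ₑ ^ 2)
    (hx : ∑' i, ‖opTensor (K i) (ContinuousLinearMap.id ℂ B) x‖ₑ ^ 2 = ‖x‖ₑ ^ 2)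
    {F : ℕ → Op (HTensor A B) (HTensor A₁ B)} (hF : IsLocalAlice F)
    {Y : ι → Ω → A₁ →L[ℂ] A₁} (hY : ∀ i a, ∑' ω, ‖Y i ω a‖ₑ ^ 2 ≤ ‖a‖ₑ ^ 2)
    (hYx : ∀ i, ∑' ω, ‖opTensor (Y i ω ∘L K i) (ContinuousLinearMap.id ℂ B) x‖ₑ ^ 2 =
      ‖opTensor (K i) (ContinuousLinearMap.id ℂ B) x‖ₑ ^ 2)
    {D : ι → Ω → Op (HTensor A₁ B) (HTensor A' B')} (hD : ∀ i ω, IsTPCP (D i ω))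
    (hD' : ∀ i ω, IsLOCCRounds A' B' m A₁ B fun _ : Unit => D i ω)
    (hI : ∀ ω, HasSum (fun i => (D i ω (ketbra
      (opTensor (Y i ω ∘L K i) (ContinuousLinearMap.id ℂ B) x))).1) (I ω (ketbra x)).1) :
    ∃ X C, Simulates (m + 1) I x X C := by
  have h1 : ∀ a, ∑' ω, ∑' i, ‖(Y i ω ∘L K i) a‖ₑ ^ 2 ≤ ‖a‖ₑ ^ 2 := fun a => by
    rw [ENNReal.tsum_comm]
    exact (ENNReal.tsum_le_tsum fun i => hY i (K i a)).trans (hK a)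
  -- For each `ω` the operators `Y i ω K i` are merged over `i` into `X ω`, and then recovered from
  -- it as `L ω i ∘ X ω`.
  choose X S hX hS using fun ω => exists_sqrt_sum (Y := fun i => Y i ω ∘L K i)
    fun a => (ENNReal.le_tsum ω).trans (h1 a)
  choose L hL hL' using fun ω => exists_family_comp_eq (R := (X ω).toLinearMap)
    (T := fun i => (Y i ω ∘L K i).toLinearMap) fun a => (hX ω a).le
  choose C hC hC' hCx using fun ω =>
    exists_prepend_alice (hL ω) hF (fun i => hD i ω) fun i => hD' i ω
  have h2 : ∀ ω i, opTensor (L ω i) (ContinuousLinearMap.id ℂ B)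
      (opTensor (X ω) (ContinuousLinearMap.id ℂ B) x) =
      opTensor (Y i ω ∘L K i) (ContinuousLinearMap.id ℂ B) x := fun ω i => by
    rw [opTensor_opTensor, comp_id_right]
    congr 2
    exact ContinuousLinearMap.ext (hL' ω i)
  refine ⟨X, C, fun a => ?_, ?_, fun ω => ⟨hC ω, hC' ω, Subtype.ext ?_⟩⟩
  · simpa only [← hX] using h1 a
  · simp only [← tsum_opTensor_left_eq (hX _) x]
    rw [ENNReal.tsum_comm, ← hx]
    exact tsum_congr hYx
  · have h3 := hCx ω (opTensor (X ω) (ContinuousLinearMap.id ℂ B) x)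
    simp only [h2] at h3
    exact (hI ω).unique (h3 (tsum_opTensor_left_eq (hX ω) x))

theorem Simulates.succ {m : ℕ} {I : Ω → Op (HTensor A B) (HTensor A' B')} {x : HTensor A B}
    {X : Ω → A →L[ℂ] A} {C : Ω → Op (HTensor A B) (HTensor A' B')} (h : Simulates m I x X C) :
    Simulates (m + 1) I x X C :=
  ⟨h.1, h.2.1, fun ω => ⟨(h.2.2 ω).1, (h.2.2 ω).2.1.succ, (h.2.2 ω).2.2⟩⟩

theorem enorm_opTensor_right_le {V : B →L[ℂ] B₁} (hV : ∀ b, ‖V b‖ ≤ ‖b‖) (x : HTensor A B) :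
    ‖opTensor (ContinuousLinearMap.id ℂ A) V x‖ₑ ^ 2 ≤ ‖x‖ₑ ^ 2 := by
  have h1 : adjoint (ContinuousLinearMap.id ℂ A) = ContinuousLinearMap.id ℂ A :=
    ContinuousLinearMap.adjoint_one
  simp only [← tsum_sliceB (opTensor _ _ x), sliceB_opTensor, h1, ← tsum_sliceB x]
  refine ENNReal.tsum_le_tsum fun j => ?_
  gcongr
  exact enorm_le_iff_norm_le.2 (hV _)

theorem exists_simulates_alice {m : ℕ} {I : Ω → Op (HTensor A B) (HTensor A' B')}
    {x : HTensor A B} {F : ℕ → Op (HTensor A B) (HTensor A₁ B)} (hF : IsLocalAlice F)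
    {P : ℕ → Ω → Op (HTensor A₁ B) (HTensor A' B')} (hP : ∀ k ω, IsBoundedPos (P k ω) 1)
    (hI : ∀ ω ρ, HasSum (fun k => (P k ω (F k ρ)).1) (I ω ρ).1)
    (ih : ∀ k y, ∃ X C, Simulates m (P k) y X C) : ∃ X C, Simulates (m + 1) I x X C := by
  choose ψ hψ using fun k => exists_nat_decomp
    ((hF.1.1 k).isPositive _ (ketbra_isPositive x)) (F k (ketbra x)).2
  obtain ⟨K, hK, hKψ⟩ := exists_kraus_left (ψ := fun i : ℕ × ℕ => ψ i.1 i.2) (x := x) fun b => by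
    rw [← hF.tsum_sliceA x hψ b, ENNReal.tsum_prod']
  choose Y D hYD using fun i : ℕ × ℕ => ih i.1 (ψ i.1 i.2)
  have h1 : ∀ i ω, opTensor (Y i ω ∘L K i) (ContinuousLinearMap.id ℂ B) x =
      opTensor (Y i ω) (ContinuousLinearMap.id ℂ B) (ψ i.1 i.2) := fun i ω => by
    rw [← hKψ, opTensor_opTensor, comp_id_right]
  refine exists_simulates_of_kraus (Y := Y) (D := D) hK ?_ hF (fun i => (hYD i).1) ?_
    (fun i ω => ((hYD i).2.2 ω).1) (fun i ω => ((hYD i).2.2 ω).2.1) fun ω => ?_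
  · simp only [hKψ]
    exact hF.1.tsum_decomp hψ
  · intro i
    simp only [h1, hKψ]
    exact (hYD i).2.1
  · simp only [h1, ← ((hYD _).2.2 ω).2.2]
    exact hasSum_decomp hF.1 (fun k => hP k ω) hψ (hI ω _)

theorem exists_simulates_bob {m : ℕ} {I : Ω → Op (HTensor A B) (HTensor A' B')}
    {x : HTensor A B} {F : ℕ → Op (HTensor A B) (HTensor A B₁)} (hF : IsLocalBob F)
    {P : ℕ → Ω → Op (HTensor A B₁) (HTensor A' B')} (hP : ∀ k ω, IsBoundedPos (P k ω) 1)
    (hI : ∀ ω ρ, HasSum (fun k => (P k ω (F k ρ)).1) (I ω ρ).1)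
    (ih : ∀ k y, ∃ X C, Simulates m (P k) y X C) : ∃ X C, Simulates (m + 2) I x X C := by
  choose ψ hψ using fun k => exists_nat_decomp
    ((hF.1.1 k).isPositive _ (ketbra_isPositive x)) (F k (ketbra x)).2
  obtain ⟨N, V, hN, hV, hNV⟩ := exists_simulation (ψ := fun i : ℕ × ℕ => ψ i.1 i.2) (x := x)
    fun a => by rw [← hF.tsum_sliceB x hψ a, ENNReal.tsum_prod']
  choose Y C hYC using fun i : ℕ × ℕ => ih i.1 (ψ i.1 i.2)
  -- Bob's correction `V i` commutes with Alice's later operator `Y i ω`, so it can be postponed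
  -- until after her whole measurement.
  have hsplit : ∀ i ω, opTensor (Y i ω) (ContinuousLinearMap.id ℂ B₁) (ψ i.1 i.2) =
      opTensor (ContinuousLinearMap.id ℂ A) (V i)
        (opTensor (Y i ω ∘L N i) (ContinuousLinearMap.id ℂ B) x) := fun i ω => by
    rw [← hNV, opTensor_opTensor, opTensor_opTensor]
    rfl
  have hsplit' : ∀ i, ψ i.1 i.2 = opTensor (ContinuousLinearMap.id ℂ A) (V i)
      (opTensor (N i) (ContinuousLinearMap.id ℂ B) x) := fun i => by
    rw [← hNV, opTensor_opTensor]
    rfl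
  have hid : opTensor (ContinuousLinearMap.id ℂ A) (ContinuousLinearMap.id ℂ B) x = x := by
    rw [opTensor_id, ContinuousLinearMap.id_apply]
  have hψx := hF.1.tsum_decomp hψ
  have hle : ∀ i : ℕ × ℕ, ‖ψ i.1 i.2‖ₑ ^ 2 ≤
      ‖opTensor (N i) (ContinuousLinearMap.id ℂ B) x‖ₑ ^ 2 := fun i => by
    rw [hsplit']
    exact enorm_opTensor_right_le (hV i) _
  have hNx : ∑' i, ‖opTensor (N i) (ContinuousLinearMap.id ℂ B) x‖ₑ ^ 2 ≤ ‖x‖ₑ ^ 2 := by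
    have h := tsum_opTensor_left_le (B := B) (X := ContinuousLinearMap.id ℂ A) hN x
    rwa [hid] at h
  -- The norms of the `ψ i` already exhaust `‖x‖²`, and contractions `V i` can only lose norm; so
  -- none is lost in any term.
  have heq : ∀ i : ℕ × ℕ, ‖ψ i.1 i.2‖ₑ ^ 2 =
      ‖opTensor (N i) (ContinuousLinearMap.id ℂ B) x‖ₑ ^ 2 :=
    eq_of_tsum_le hle (hψx ▸ hNx) (hψx ▸ enorm_sq_ne_top x)
  have hYle : ∀ i, ∑' ω, ‖opTensor (Y i ω ∘L N i) (ContinuousLinearMap.id ℂ B) x‖ₑ ^ 2 ≤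
      ‖opTensor (N i) (ContinuousLinearMap.id ℂ B) x‖ₑ ^ 2 := fun i =>
    tsum_opTensor_left_le (Y := fun ω => Y i ω ∘L N i) (fun a => (hYC i).1 (N i a)) x
  -- The same saturation after Alice's `Y i ω`: `V i` preserves the norm of the vectors on which it
  -- is really applied.
  have hYeq : ∀ i ω, ‖opTensor (Y i ω) (ContinuousLinearMap.id ℂ B₁) (ψ i.1 i.2)‖ₑ ^ 2 =
      ‖opTensor (Y i ω ∘L N i) (ContinuousLinearMap.id ℂ B) x‖ₑ ^ 2 := fun i => by
    refine eq_of_tsum_le (fun ω => ?_) ?_ ?_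
    · rw [hsplit]
      exact enorm_opTensor_right_le (hV i) _
    · rw [(hYC i).2.1, heq]
      exact hYle i
    · rw [(hYC i).2.1]
      exact enorm_sq_ne_top _
  -- `D i ω` begins with Bob's correction `V i`, a one-element Kraus family completed by means of
  -- his own instrument; this costs the second extra round.
  choose D hD hD' hDx using fun (i : ℕ × ℕ) ω => exists_prepend_bob (ι := Unit) (L := fun _ => V i)
    (fun b => by
      simpa using! pow_le_pow_left₀ zero_le (enorm_le_iff_norm_le.2 (hV i b)) 2) hF
    (D := fun _ => C i ω) (fun _ => ((hYC i).2.2 ω).1) fun _ => ((hYC i).2.2 ω).2.1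
  refine exists_simulates_of_kraus (Y := Y) (D := D) hN ?_ trivialInstrument_isLocalAlice
    (fun i => (hYC i).1) ?_ hD hD' fun ω => ?_
  · simp only [← heq, hψx]
  · intro i
    simp only [← hYeq, ← heq]
    exact (hYC i).2.1
  · convert! hasSum_decomp hF.1 (fun k => hP k ω) hψ (hI ω _) using 2 with i
    have h := hDx i ω (opTensor (Y i ω ∘L N i) (ContinuousLinearMap.id ℂ B) x)
    simp only [tsum_fintype, Finset.univ_unique, Finset.sum_const, Finset.card_singleton, one_smul,
      ← hsplit, hYeq] at h
    rw [((hYC i).2.2 ω).2.2]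
    exact (h trivial).unique (hasSum_unique _)

/-- Every LOCC protocol can be simulated on a given state vector by a measurement of Alice
followed by quantum operations with LOCC. -/
theorem IsLOCCRounds.exists_simulates {n : ℕ} {I : Ω → Op (HTensor A B) (HTensor A' B')}
    (h : IsLOCCRounds A' B' n A B I) (x : HTensor A B) : ∃ X C, Simulates (2 * n) I x X C := by
  classical
  induction n generalizing A B with
  | zero =>
    obtain ⟨ω₀, E, G, hE, hG, h1, h2, h3⟩ := h
    have hX : ∀ a : A, ∑' ω, ‖(if ω = ω₀ then ContinuousLinearMap.id ℂ A else 0 : A →L[ℂ] A) a‖ₑ ^ 2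
        = ‖a‖ₑ ^ 2 := fun a => by
      rw [tsum_eq_single ω₀ fun ω hω => by simp [hω]]
      simp
    -- For `ω ≠ ω₀` the channel receives the zero vector, so `I ω₀`, the only trace preserving map
    -- at hand, can serve for all `ω`.
    refine ⟨fun ω => if ω = ω₀ then ContinuousLinearMap.id ℂ A else 0, fun _ => I ω₀,
      fun a => (hX a).le, ?_, fun ω => ⟨h1, ⟨(), E, G, hE, hG, h1, h2, by simp⟩, ?_⟩⟩
    · rw [tsum_opTensor_left_eq (X := ContinuousLinearMap.id ℂ A) hX, opTensor_id,
        ContinuousLinearMap.id_apply]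
    · by_cases hω : ω = ω₀
      · subst hω
        simp [opTensor_id]
      · have h4 : ketbra (0 : HTensor A B) = 0 := Subtype.ext (by simp [ketbra])
        simp [hω, h3, opTensor_zero_left, h4]
  | succ n ih =>
    rcases h with ⟨A₁, _, _, _, F, P, hF, hP, h⟩ | ⟨B₁, _, _, _, F, P, hF, hP, h⟩
    · obtain ⟨X, C, hXC⟩ := exists_simulates_alice (x := x) hF (fun k ω => (hP k).isBoundedPos ω) h
        fun k y => ih (hP k) y
      -- A round of Alice costs one round and a round of Bob two; padding makes both fit `2 * (n +
      -- 1)`.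
      exact ⟨X, C, hXC.succ⟩
    · exact exists_simulates_bob hF (fun k ω => (hP k).isBoundedPos ω) h fun k y => ih (hP k) y

end Simulation

/-! ### POVMs from square roots -/

section POVM

variable {H : Type*} [NormedAddCommGroup H] [InnerProductSpace ℂ H] [CompleteSpace H]

theorem isPOVM_of_tsum {Ω : Type*} {M : Ω → H →L[ℂ] H} (hM : ∀ ω, (M ω).IsPositive)
    (h : ∀ x, ∑' ω, ‖CFC.sqrt (M ω) x‖ₑ ^ 2 = ‖x‖ₑ ^ 2) : IsPOVM M := by
  classical
  refine ⟨hM, fun x => ?_⟩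
  obtain ⟨T, h1, h2⟩ := exists_column (fun ω => (CFC.sqrt (M ω)).toLinearMap) fun x =>
    (h x).trans_ne (enorm_sq_ne_top x)
  have h3 : ∀ x, ‖T x‖ = ‖x‖ := fun x => le_antisymm
    (norm_le_of_enorm_sq_le ((h2 x).trans (h x)).le) (norm_le_of_enorm_sq_le ((h2 x).trans (h x)).ge)
  let T' : H →L[ℂ] lp (fun _ : Ω => H) 2 := T.mkContinuous 1 fun x => by rw [one_mul, h3]
  have h4 : adjoint T' ∘L T' = 1 := (ContinuousLinearMap.norm_map_iff_adjoint_comp_self T').1 h3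
  have h5 : ∀ ω y, adjoint T' (lp.single 2 ω y) = CFC.sqrt (M ω) y := fun ω y =>
    ext_inner_right ℂ fun z => by
      rw [ContinuousLinearMap.adjoint_inner_left, lp.inner_single_left, sqrt_inner_comm]
      exact congrArg (inner ℂ y) (h1 z ω)
  -- The column `T'` of the `√(M ω)` is an isometry. Applying `T'*` to the expansion of `T' x` into
  -- its components gives `x = ∑ M ω x` with norm convergence.
  have h6 := (lp.hasSum_single ENNReal.ofNat_ne_top (T' x)).mapL (adjoint T')
  simp only [h5] at h6
  have h7 : adjoint T' (T' x) = x := DFunLike.congr_fun h4 x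
  rw [h7] at h6
  convert! h6 using 2 with ω
  have h8 : T' x ω = CFC.sqrt (M ω) x := h1 x ω
  rw [h8]
  exact (DFunLike.congr_fun (CFC.sqrt_mul_sqrt_self (M ω)
    ((ContinuousLinearMap.nonneg_iff_isPositive _).2 (hM ω))) x).symm

theorem enorm_sqrt_add (X S : H →L[ℂ] H) (x : H) :
    ‖CFC.sqrt (adjoint X ∘L X + adjoint S ∘L S) x‖ₑ ^ 2 = ‖X x‖ₑ ^ 2 + ‖S x‖ₑ ^ 2 := by
  have hp := (ContinuousLinearMap.isPositive_adjoint_comp_self X).add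
    (ContinuousLinearMap.isPositive_adjoint_comp_self S)
  rw [← qf_eq_sqrt hp, qf, add_apply, inner_add_right, ContinuousLinearMap.comp_apply,
    ContinuousLinearMap.comp_apply, ContinuousLinearMap.adjoint_inner_right,
    ContinuousLinearMap.adjoint_inner_right, inner_self_eq_ofReal, inner_self_eq_ofReal,
    enorm_sq_eq_ofReal, enorm_sq_eq_ofReal, ← Complex.ofReal_add, Complex.ofReal_re,
    ENNReal.ofReal_add (by positivity) (by positivity)]

end POVM

/-! ### Normalization to a POVM -/

section Main

universe u v w
variable {Ω : Type w} {A A' : Type u} {B B' : Type v}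
  [NormedAddCommGroup A] [InnerProductSpace ℂ A] [CompleteSpace A]
  [NormedAddCommGroup B] [InnerProductSpace ℂ B] [CompleteSpace B]
  [NormedAddCommGroup A'] [InnerProductSpace ℂ A'] [CompleteSpace A']
  [NormedAddCommGroup B'] [InnerProductSpace ℂ B'] [CompleteSpace B']

/-- A simulation can be normalized so that the measurement of Alice is given by the square roots
of a POVM. -/
theorem Simulates.exists_povm {m : ℕ} {I : Ω → Op (HTensor A B) (HTensor A' B')}
    {x : HTensor A B} (hx : x ≠ 0) {X : Ω → A →L[ℂ] A}
    {C : Ω → Op (HTensor A B) (HTensor A' B')} (h : Simulates m I x X C) :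
    ∃ (M : Ω → A →L[ℂ] A) (D : Ω → Op (HTensor A B) (HTensor A' B')), IsPOVM M ∧
      ∀ ω, IsLOCCOperation (D ω) ∧ I ω (ketbra x) =
        D ω (ketbra (opTensor (CFC.sqrt (M ω)) (ContinuousLinearMap.id ℂ B) x)) := by
  classical
  obtain ⟨hX, hXx, hC⟩ := h
  -- Without outcomes the total norm would be zero, contradicting `x ≠ 0`.
  have hΩ : Nonempty Ω := by
    by_contra hne
    rw [not_nonempty_iff] at hne
    rw [tsum_empty] at hXx
    exact hx (by simpa using hXx.symm)
  obtain ⟨-, S, -, hS⟩ := exists_sqrt_sum hX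
  have hSx : ‖opTensor S (ContinuousLinearMap.id ℂ B) x‖ₑ ^ 2 = 0 := by
    have h1 := tsum_opTensor_left_compl hS x
    rw [hXx] at h1
    exact (ENNReal.add_right_inj (enorm_sq_ne_top x)).1 (h1.trans (add_zero _).symm)
  let ω₀ : Ω := Classical.choice hΩ
  -- The whole defect goes to one arbitrary value `ω₀`; this is harmless because `(S ⊗ 1) x = 0`.
  let S' : Ω → A →L[ℂ] A := fun ω => if ω = ω₀ then S else 0
  let M : Ω → A →L[ℂ] A := fun ω => adjoint (X ω) ∘L X ω + adjoint (S' ω) ∘L S' ω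
  have hM : ∀ ω a, ‖CFC.sqrt (M ω) a‖ₑ ^ 2 = ‖X ω a‖ₑ ^ 2 + ‖S' ω a‖ₑ ^ 2 := fun ω a =>
    enorm_sqrt_add _ _ a
  have hMx : ∀ ω, ‖opTensor (X ω) (ContinuousLinearMap.id ℂ B) x‖ₑ ^ 2 =
      ‖opTensor (CFC.sqrt (M ω)) (ContinuousLinearMap.id ℂ B) x‖ₑ ^ 2 := fun ω => by
    have h1 := tsum_opTensor_left_eq (Y := ![X ω, S' ω]) (X := CFC.sqrt (M ω))
      (fun a => by simp [tsum_fintype, hM]) x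
    rw [← h1, tsum_fintype, Fin.sum_univ_two]
    have h2 : ‖opTensor (S' ω) (ContinuousLinearMap.id ℂ B) x‖ₑ ^ 2 = 0 := by
      by_cases hω : ω = ω₀
      · simpa only [S', hω, if_true] using hSx
      · simp [S', hω, opTensor_zero_left]
    exact (add_zero _).symm.trans (congrArg _ h2.symm)
  -- `X ω* X ω ≤ M ω` gives `X ω = L √(M ω)` with a contraction `L`, performed as an extra round
  -- before `C ω`; by `hMx` it loses no norm on the vector concerned.
  choose L hL hL' using fun ω => exists_family_comp_eq (ι := Unit)
    (R := (CFC.sqrt (M ω)).toLinearMap) (T := fun _ => (X ω).toLinearMap) fun a => by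
      rw [tsum_fintype, Finset.univ_unique, Finset.sum_singleton]
      exact (hM ω a).symm ▸ le_self_add
  choose D hD hD' hDx using fun ω => exists_prepend_alice (hL ω)
    trivialInstrument_isLocalAlice (fun _ => (hC ω).1) fun _ => (hC ω).2.1
  refine ⟨M, D, isPOVM_of_tsum (fun ω => (ContinuousLinearMap.isPositive_adjoint_comp_self _).add
    (ContinuousLinearMap.isPositive_adjoint_comp_self _)) fun a => ?_,
    fun ω => ⟨⟨hD ω, m + 1, hD' ω⟩, Subtype.ext ?_⟩⟩
  · have h2 : ∑' ω, ‖S' ω a‖ₑ ^ 2 = ‖S a‖ₑ ^ 2 := by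
      rw [tsum_eq_single ω₀ fun ω hω => by simp [S', hω]]
      simp [S']
    simp only [hM]
    rw [ENNReal.tsum_add, h2, hS]
  · have h2 : ∀ i, opTensor (L ω i) (ContinuousLinearMap.id ℂ B)
        (opTensor (CFC.sqrt (M ω)) (ContinuousLinearMap.id ℂ B) x) =
        opTensor (X ω) (ContinuousLinearMap.id ℂ B) x := fun i => by
      rw [opTensor_opTensor, comp_id_right]
      congr 2
      exact ContinuousLinearMap.ext (hL' ω i)
    have h3 := hDx ω (opTensor (CFC.sqrt (M ω)) (ContinuousLinearMap.id ℂ B) x)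
    simp only [h2, tsum_fintype, Finset.univ_unique, Finset.sum_const, Finset.card_singleton,
      one_smul] at h3
    rw [(hC ω).2.2]
    exact (hasSum_unique _).unique (h3 (hMx ω))

end Main

end LOCC

end

theorem mainTheorem5 {A B Ω : Type*}
    [NormedAddCommGroup A] [InnerProductSpace ℂ A] [CompleteSpace A]
    [NormedAddCommGroup B] [InnerProductSpace ℂ B] [CompleteSpace B]
    (I : Ω → Op (HTensor A B) (HTensor A B)) (hI : IsLOCCInstrument I)
    (Φ : HTensor A B) (hΦ : ‖Φ‖ = 1) :
    ∃ (M : Ω → A →L[ℂ] A) (C : Ω → Op (HTensor A B) (HTensor A B)),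
      IsPOVM M ∧
      ∀ ω, IsLOCCOperation (C ω) ∧
        I ω (ketbra Φ) =
          C ω (ketbra (opTensor (CFC.sqrt (M ω)) (ContinuousLinearMap.id ℂ B) Φ)) := by
  obtain ⟨-, n, hn⟩ := hI
  obtain ⟨X, C, h⟩ := hn.exists_simulates Φ
  exact h.exists_povm (norm_ne_zero_iff.1 (hΦ ▸ one_ne_zero))
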